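/- Fix an integer $r\ge 2$. \textbf{Max $r$-CSP.} An instance consists of $n$ Boolean variables and a collection (repetitions allowed) of $m$ Boolean functions, each given by its truth table and acting on a list of at most $r$ distinct variables, together with a parameter $k\in\mathbb{N}$. The question is whether some truth assignment satisfies at least $E+k2^{-r}$ of the functions, where $E$ is the average number of satisfied functions over all $2^n$ truth assignments. \textbf{Max $r$-Lin AA.} An instance consists of a system of linear equations over $\mathbb{F}_2$ in $n'$ variables, each equation having at most $r$ variables and a positive integral weight, together with a parameter $k'\in\mathbb{N}$. The question is whether some assignment has excess (total weight of satisfied equations minus total weight of falsified equations) at least $k'$. A \emph{bikernelization} from Max $r$-CSP to Max $r$-Lin AA is a polynomial-time algorithm that maps each instance $(x,k)$ of the former to an instance $(x',k')$ of the latter (the \emph{bikernel}) such that (i) $(x,k)$ is a yes-instance if and only if $(x',k')$ is, (ii) $k'\le f(k)$ and (iii) $|x'|\le s(k)$ for some functions $f,s:\mathbb{N}\to\mathbb{N}$. Here $|x|$ is the size of the encoding of $x$; numbers are written in binary. Then: (a) There is a bikernelization from Max $r$-CSP to Max $r$-Lin AA whose bikernels have $O(k\log k)$ variables, i.e. $n'\le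 g(k)$ for all instances, for some $g:\mathbb{N}\to\mathbb{N}$ with $g(k)=O(k\log k)$ as $k\to\infty$. (b) There is an algorithm that decides Max $r$-CSP in time at most $2^{g(k)}+P(|x|)$ on every instance $(x,k)$, and in time at most $2^{g(k)}+Q(m)$ if every variable of $x$ occurs in one of its functions, for some polynomials $P,Q$ and some $g:\mathbb{N}\to\mathbb{N}$ with $g(k)=O(k\log k)$ as $k\to\infty$. Thus Max $r$-CSP is solvable in time $2^{O(k\log k)}+m^{O(1)}$. -/

import Mathlib

open Filter Asymptotics

/-! ### The model of computation

Data are finite binary trees, in which lists, numbers and so on are written in the usual way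
(as LISP does).  Programs are built from the elementary tree operations by composition, pairing,
branching and unbounded loops.  Every elementary operation, every duplication of a value and every
test is charged the size of the tree that it handles (plus one).  Hence the running time bounds the
sizes of all values that occur, and the model and multitape Turing machines simulate each other with
polynomial overhead. -/

/-- Binary trees, the data of programs. -/
inductive BTree : Type
  | nil : BTree
  | cons : BTree → BTree → BTree

/-- The size of a tree: the number of its nodes, leaves included. -/
def BTree.size : BTree → ℕ
  | .nil => 1
  | .cons a b => a.size + b.size + 1

/-- Programs; each denotes a partial function from trees to trees, with a running time. -/
inductive Prog : Type
  | id : Prog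
  | nil : Prog
  | fst : Prog
  | snd : Prog
  | pair : Prog → Prog → Prog
  | comp : Prog → Prog → Prog
  | branch : Prog → Prog → Prog → Prog
  | loop : Prog → Prog → Prog

/-- `Prog.Runs p x y t`: on input `x` the program `p` halts with output `y` after time `t`.
As a truth value, `nil` means false and every other tree means true. -/
inductive Prog.Runs : Prog → BTree → BTree → ℕ → Prop
  | id (x : BTree) : Runs .id x x (x.size + 1)
  | nil (x : BTree) : Runs .nil x .nil (x.size + 1)
  | fst_nil : Runs .fst .nil .nil (BTree.nil.size + 1)
  | fst_cons (a b : BTree) : Runs .fst (.cons a b) a ((BTree.cons a b).size + 1)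
  | snd_nil : Runs .snd .nil .nil (BTree.nil.size + 1)
  | snd_cons (a b : BTree) : Runs .snd (.cons a b) b ((BTree.cons a b).size + 1)
  | pair {p q : Prog} {x y z : BTree} {s t : ℕ} :
      Runs p x y s → Runs q x z t → Runs (.pair p q) x (.cons y z) (s + t + x.size + 1)
  -- first `q`, then `p`
  | comp {p q : Prog} {x y z : BTree} {s t : ℕ} :
      Runs q x y s → Runs p y z t → Runs (.comp p q) x z (s + t + 1)
  -- `branch c p q`: if `c` then `p` else `q`
  | branch_true {c p q : Prog} {x a b y : BTree} {s t : ℕ} :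
      Runs c x (.cons a b) s → Runs p x y t → Runs (.branch c p q) x y (s + t + x.size + 1)
  | branch_false {c p q : Prog} {x y : BTree} {s t : ℕ} :
      Runs c x .nil s → Runs q x y t → Runs (.branch c p q) x y (s + t + x.size + 1)
  -- `loop c p`: while `c` do `p`
  | loop_true {c p : Prog} {x a b y z : BTree} {s t u : ℕ} :
      Runs c x (.cons a b) s → Runs p x y t → Runs (.loop c p) y z u →
      Runs (.loop c p) x z (s + t + u + x.size + 1)
  | loop_false {c p : Prog} {x : BTree} {s : ℕ} :
      Runs c x .nil s → Runs (.loop c p) x x (s + x.size + 1)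

/-! ### Encodings -/

/-- The tree of a truth value. -/
def encBool : Bool → BTree
  | false => .nil
  | true => .cons .nil .nil

/-- The tree of a list. -/
def encList {α : Type} (e : α → BTree) : List α → BTree
  | [] => .nil
  | a :: l => .cons (e a) (encList e l)

/-- The tree of a natural number: its binary digits, the least significant one first. -/
def encNat (n : ℕ) : BTree := encList encBool n.bits

/-- The truth table of a Boolean function, as a complete binary tree of depth `a`. -/
def encTable : (a : ℕ) → ((Fin a → Bool) → Bool) → BTree
  | 0, f => encBool (f Fin.elim0)
  | a + 1, f => .cons (encTable a fun v => f (Fin.cons false v))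
      (encTable a fun v => f (Fin.cons true v))

theorem encBool_injective : Function.Injective encBool := by
  intro a b h
  cases a <;> cases b <;> simp_all [encBool]

theorem encList_injective {α : Type} {e : α → BTree} (he : Function.Injective e) :
    Function.Injective (encList e) := by
  intro l
  induction l with
  | nil => intro l' h; cases l' <;> simp_all [encList]
  | cons a l ih =>
    intro l' h
    cases l' with
    | nil => simp [encList] at h
    | cons b l' =>
      simp only [encList, BTree.cons.injEq] at h
      rw [he h.1, ih h.2]

theorem encNat_injective : Function.Injective encNat := by
  intro m n h
  have h' := encList_injective encBool_injective h
  apply Nat.eq_of_testBit_eq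
  intro i
  rw [Nat.testBit_eq_inth, Nat.testBit_eq_inth, h']

theorem encTable_injective (a : ℕ) : Function.Injective (encTable a) := by
  induction a with
  | zero =>
    intro f g h
    funext v
    rw [Subsingleton.elim v Fin.elim0]
    exact encBool_injective h
  | succ a ih =>
    intro f g h
    simp only [encTable, BTree.cons.injEq] at h
    funext v
    rw [← Fin.cons_self_tail v]
    cases v 0
    · exact congrFun (ih h.1) (Fin.tail v)
    · exact congrFun (ih h.2) (Fin.tail v)

/-! ### Parameterized problems and bikernelizations -/

/-- A parameterized problem: its instances, written as trees, and its yes-instances `(x, k)`,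
with parameter `k`. -/
structure ParamProblem where
  Inst : Type
  enc : Inst → BTree
  enc_injective : Function.Injective enc
  Yes : Inst → ℕ → Prop

/-- The input that a program gets for `(x, k)`; the parameter is written in binary. -/
def ParamProblem.code (L : ParamProblem) (x : L.Inst) (k : ℕ) : BTree :=
  .cons (L.enc x) (encNat k)

/-- `F` is a bikernelization from `L` to `L'`: it is computable in polynomial time, it preserves
the answer, and the new parameter and the size of the new instance are bounded by functions of the
old parameter. -/
def IsBikernelization (L L' : ParamProblem) (F : L.Inst → ℕ → L'.Inst × ℕ) : Prop :=
  (∃ (p : Prog) (P : Polynomial ℕ), ∀ x k, ∃ t ≤ P.eval (L.code x k).size,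
    p.Runs (L.code x k) (L'.code (F x k).1 (F x k).2) t) ∧
  (∀ x k, L.Yes x k ↔ L'.Yes (F x k).1 (F x k).2) ∧
  (∃ f : ℕ → ℕ, ∀ x k, (F x k).2 ≤ f k) ∧
  (∃ g : ℕ → ℕ, ∀ x k, (L'.enc (F x k).1).size ≤ g k)

/-! ### Max `r`-CSP -/

/-- A Boolean function, given by its truth table, acting on a list of at most `r` distinct ones of
`n` Boolean variables. -/
structure Constraint (r n : ℕ) where
  vars : List (Fin n)
  nodup : vars.Nodup
  length_le : vars.length ≤ r
  table : (Fin vars.length → Bool) → Bool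

/-- The value of the function at a truth assignment to all `n` variables. -/
def Constraint.eval {r n : ℕ} (c : Constraint r n) (x : Fin n → Bool) : Bool :=
  c.table fun j => x (c.vars.get j)

def Constraint.enc {r n : ℕ} (c : Constraint r n) : BTree :=
  .cons (encList (fun i : Fin n => encNat i) c.vars) (encTable c.vars.length c.table)

/-- An instance of Max `r`-CSP: a collection (repetitions allowed) of Boolean functions of at most
`r` variables each. -/
structure CSP (r : ℕ) where
  numVars : ℕ
  constraints : List (Constraint r numVars)

/-- The number `m` of functions. -/
def CSP.numConstraints {r : ℕ} (I : CSP r) : ℕ := I.constraints.length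

/-- The number of functions that the assignment satisfies. -/
def CSP.numSat {r : ℕ} (I : CSP r) (x : Fin I.numVars → Bool) : ℕ :=
  I.constraints.countP fun c => c.eval x

/-- The average number of satisfied functions over all truth assignments. -/
def CSP.average {r : ℕ} (I : CSP r) : ℚ :=
  (∑ x : Fin I.numVars → Bool, (I.numSat x : ℚ)) / 2 ^ I.numVars

/-- Every one of the variables occurs in some function. -/
def CSP.AllVarsOccur {r : ℕ} (I : CSP r) : Prop :=
  ∀ i : Fin I.numVars, ∃ c ∈ I.constraints, i ∈ c.vars

def CSP.enc {r : ℕ} (I : CSP r) : BTree :=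
  .cons (encNat I.numVars) (encList Constraint.enc I.constraints)

theorem encFin_injective (n : ℕ) : Function.Injective fun i : Fin n => encNat i :=
  encNat_injective.comp Fin.val_injective

theorem Constraint.enc_injective (r n : ℕ) :
    Function.Injective (Constraint.enc : Constraint r n → BTree) := by
  rintro ⟨v, h₁, h₂, f⟩ ⟨w, h₃, h₄, g⟩ h
  simp only [Constraint.enc, BTree.cons.injEq] at h
  obtain rfl := encList_injective (encFin_injective n) h.1
  obtain rfl := encTable_injective _ h.2
  rfl

theorem CSP.enc_injective (r : ℕ) : Function.Injective (CSP.enc : CSP r → BTree) := by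
  rintro ⟨n, l⟩ ⟨n', l'⟩ h
  simp only [CSP.enc, BTree.cons.injEq] at h
  obtain rfl := encNat_injective h.1
  obtain rfl := encList_injective (Constraint.enc_injective r n) h.2
  rfl

/-- Max `r`-CSP above average: can at least `E + k * 2 ^ (-r)` functions be satisfied, where `E` is
the average number of satisfied functions? -/
def MaxCSP (r : ℕ) : ParamProblem where
  Inst := CSP r
  enc := CSP.enc
  enc_injective := CSP.enc_injective r
  Yes I k := ∃ x : Fin I.numVars → Bool, I.average + (k : ℚ) / 2 ^ r ≤ I.numSat x

/-! ### Max `r`-Lin AA -/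

/-- An equation `∑ i ∈ vars, z i = rhs` over `𝔽₂` with at most `r` of `n` variables and with a
positive integral weight. -/
structure LinEquation (r n : ℕ) where
  vars : List (Fin n)
  nodup : vars.Nodup
  length_le : vars.length ≤ r
  rhs : ZMod 2
  weight : ℕ
  weight_pos : 0 < weight

def LinEquation.Satisfied {r n : ℕ} (e : LinEquation r n) (z : Fin n → ZMod 2) : Prop :=
  (e.vars.map z).sum = e.rhs

instance LinEquation.decidableSatisfied {r n : ℕ} (e : LinEquation r n) (z : Fin n → ZMod 2) :
    Decidable (e.Satisfied z) :=
  inferInstanceAs (Decidable ((e.vars.map z).sum = e.rhs))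

def LinEquation.enc {r n : ℕ} (e : LinEquation r n) : BTree :=
  .cons (encList (fun i : Fin n => encNat i) e.vars) (.cons (encNat e.rhs.val) (encNat e.weight))

/-- A weighted system of linear equations over `𝔽₂` with at most `r` variables per equation. -/
structure LinSystem (r : ℕ) where
  numVars : ℕ
  equations : List (LinEquation r numVars)

/-- The excess of an assignment: the total weight of the satisfied equations minus the total weight
of the falsified ones. -/
def LinSystem.excess {r : ℕ} (S : LinSystem r) (z : Fin S.numVars → ZMod 2) : ℤ :=
  (S.equations.map fun e => if e.Satisfied z then (e.weight : ℤ) else -(e.weight : ℤ)).sum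

def LinSystem.enc {r : ℕ} (S : LinSystem r) : BTree :=
  .cons (encNat S.numVars) (encList LinEquation.enc S.equations)

theorem LinEquation.enc_injective (r n : ℕ) :
    Function.Injective (LinEquation.enc : LinEquation r n → BTree) := by
  rintro ⟨v, h₁, h₂, b, w, hw⟩ ⟨v', h₃, h₄, b', w', hw'⟩ h
  simp only [LinEquation.enc, BTree.cons.injEq] at h
  obtain rfl := encList_injective (encFin_injective n) h.1
  obtain rfl := ZMod.val_injective 2 (encNat_injective h.2.1)
  obtain rfl := encNat_injective h.2.2
  rfl

theorem LinSystem.enc_injective (r : ℕ) :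
    Function.Injective (LinSystem.enc : LinSystem r → BTree) := by
  rintro ⟨n, l⟩ ⟨n', l'⟩ h
  simp only [LinSystem.enc, BTree.cons.injEq] at h
  obtain rfl := encNat_injective h.1
  obtain rfl := encList_injective (LinEquation.enc_injective r n) h.2
  rfl

/-- Max `r`-Lin AA: is the maximum excess at least `k`? -/
def MaxLinAA (r : ℕ) : ParamProblem where
  Inst := LinSystem r
  enc := LinSystem.enc
  enc_injective := LinSystem.enc_injective r
  Yes S k := ∃ z : Fin S.numVars → ZMod 2, (k : ℤ) ≤ S.excess z

/-- `g(k) = O(k log k)`. -/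
def IsBigOKLogK (g : ℕ → ℕ) : Prop :=
  (fun k => (g k : ℝ)) =O[atTop] fun k : ℕ => (k : ℝ) * Real.log k

/-!
The Fourier expansion writes `2 ^ r` times the number of satisfied functions minus its average as
a sum of signs `± (-1) ^ (∑ i ∈ S, x i)` with `S` nonempty, that is, as the excess of a system of
linear equations; hence `(I, k)` is a yes-instance iff this excess can reach `k`. Cancel opposite
equations and let `M` be the set of the left-hand sides that survive, as vectors over `𝔽₂`, so that
the excess is an integral combination of the characters indexed by `M`.

The excess reaches the value `K.card` whenever `K ⊆ M` is *isolated*: no nonempty subset of `K` has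
sum `0` and no subset with at least two elements has its sum in `M`. Indeed the Riesz product
`∏ s ∈ K, (1 ± χ s)` is a nonnegative weight of mean `1`, against which the mean of the excess is
the sum of the weights `|c s| ≥ 1` for `s ∈ K`. A singleton shows that the excess reaches every
weight of an equation. To find a large `K`, start from a random subset of `M`: its sum is nonzero
in at least half of the `n` coordinates, for some choice. A smallest subset of `M` with the same sum
is isolated, and as each vector has at most `r` nonzero coordinates, it has at least `n / (2 * r)`
elements.

Therefore the answer is yes as soon as a weight is at least `k` or `n > 2 * r * k`. Otherwise
the surviving system is a bikernel with at most `2 * r * k` variables, and trying all assignments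
takes time `2 ^ O(k)` times a polynomial.
-/

/-! ### Polynomial-time programs -/

/-- A representation of the elements of a type by trees, through which programs compute functions
between types. -/
class TreeEnc (α : Type) where
  enc : α → BTree

namespace TreeEnc

instance : TreeEnc BTree := ⟨fun t => t⟩

instance : TreeEnc Bool := ⟨encBool⟩

instance : TreeEnc ℕ := ⟨encNat⟩

instance {α : Type} [TreeEnc α] : TreeEnc (List α) := ⟨encList enc⟩

instance {α β : Type} [TreeEnc α] [TreeEnc β] : TreeEnc (α × β) :=
  ⟨fun p => .cons (enc p.1) (enc p.2)⟩

end TreeEnc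

open TreeEnc

/-- `g` is at most a polynomial in `B`. -/
def IsPolyBounded {α : Type} (B g : α → ℕ) : Prop :=
  ∃ P : Polynomial ℕ, ∀ a, g a ≤ P.eval (B a)

/-- The first subtree, with the convention of `Prog.fst` that a leaf is its own subtree. -/
def BTree.left : BTree → BTree
  | .nil => .nil
  | .cons a _ => a

/-- The second subtree, with the convention of `Prog.snd` that a leaf is its own subtree. -/
def BTree.right : BTree → BTree
  | .nil => .nil
  | .cons _ b => b

/-- The truth value of a tree. -/
def BTree.isCons : BTree → Bool
  | .nil => false
  | .cons _ _ => true

theorem eval_le_eval (P : Polynomial ℕ) {m n : ℕ} (h : m ≤ n) : P.eval m ≤ P.eval n := by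
  simp only [Polynomial.eval_eq_sum, Polynomial.sum]
  exact Finset.sum_le_sum fun i _ => Nat.mul_le_mul_left _ (Nat.pow_le_pow_left h i)

namespace IsPolyBounded

variable {α β : Type} {B g h : α → ℕ}

theorem mono (hh : IsPolyBounded B h) (hg : ∀ a, g a ≤ h a) : IsPolyBounded B g :=
  hh.imp fun _ hP a => (hg a).trans (hP a)

theorem refl (B : α → ℕ) : IsPolyBounded B B :=
  ⟨.X, fun a => by simp⟩

theorem const (B : α → ℕ) (c : ℕ) : IsPolyBounded B fun _ => c :=
  ⟨.C c, fun a => by simp⟩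

theorem add (hg : IsPolyBounded B g) (hh : IsPolyBounded B h) :
    IsPolyBounded B fun a => g a + h a := by
  obtain ⟨P, hP⟩ := hg
  obtain ⟨Q, hQ⟩ := hh
  exact ⟨P + Q, fun a => by simpa using add_le_add (hP a) (hQ a)⟩

theorem mul (hg : IsPolyBounded B g) (hh : IsPolyBounded B h) :
    IsPolyBounded B fun a => g a * h a := by
  obtain ⟨P, hP⟩ := hg
  obtain ⟨Q, hQ⟩ := hh
  exact ⟨P * Q, fun a => by simpa using mul_le_mul' (hP a) (hQ a)⟩

theorem eval (hg : IsPolyBounded B g) (P : Polynomial ℕ) :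
    IsPolyBounded B fun a => P.eval (g a) := by
  obtain ⟨Q, hQ⟩ := hg
  exact ⟨P.comp Q, fun a => by simpa using eval_le_eval P (hQ a)⟩

theorem comp {B' g' : β → ℕ} {f : α → β} (hg : IsPolyBounded B' g')
    (hf : IsPolyBounded B fun a => B' (f a)) : IsPolyBounded B fun a => g' (f a) := by
  obtain ⟨P, hP⟩ := hg
  exact (hf.eval P).mono fun a => hP (f a)

end IsPolyBounded

/-- The size of the tree that represents an element. -/
def tsize {α : Type} [TreeEnc α] (a : α) : ℕ := (enc a).size

/-- A program computes `f` in a time that is at most a polynomial in the cost measure `B`. -/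
def PolyTimeIn {α β : Type} [TreeEnc α] [TreeEnc β] (B : α → ℕ) (f : α → β) : Prop :=
  ∃ (p : Prog) (t : α → ℕ), IsPolyBounded B t ∧ ∀ a, p.Runs (enc a) (enc (f a)) (t a)

/-- `f` is computable in polynomial time. -/
@[fun_prop]
def PolyTime {α β : Type} [TreeEnc α] [TreeEnc β] (f : α → β) : Prop :=
  PolyTimeIn tsize f

theorem Prog.Runs.size_le {p : Prog} {x y : BTree} {t : ℕ} (h : p.Runs x y t) :
    x.size ≤ t ∧ y.size ≤ t := by
  induction h <;> (try simp only [BTree.size] at *) <;> omega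

section

variable {α β γ δ σ τ : Type} [TreeEnc α] [TreeEnc β] [TreeEnc γ] [TreeEnc δ] [TreeEnc σ]
  [TreeEnc τ]

theorem tsize_pair (a : α) (b : β) : tsize (a, b) = tsize a + tsize b + 1 := rfl

theorem tsize_nil : tsize ([] : List α) = 1 := rfl

theorem tsize_cons (a : α) (l : List α) : tsize (a :: l) = tsize a + tsize l + 1 := rfl

theorem tsize_pos (a : α) : 0 < tsize a := by
  unfold tsize
  cases enc a <;> simp [BTree.size]

theorem tsize_bool_le (b : Bool) : tsize b ≤ 3 := by
  cases b <;> simp [tsize, enc, encBool, BTree.size]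

theorem length_lt_tsize (l : List α) : l.length < tsize l := by
  induction l with
  | nil => simp [tsize_nil]
  | cons a l ih => rw [tsize_cons, List.length_cons]; omega

theorem tsize_append (l l' : List α) : tsize (l ++ l') + 1 = tsize l + tsize l' := by
  induction l with
  | nil => rw [List.nil_append, tsize_nil]; omega
  | cons a l ih => rw [List.cons_append, tsize_cons, tsize_cons]; omega

theorem tsize_list_le {l : List α} {N : ℕ} (h : ∀ a ∈ l, tsize a ≤ N) :
    tsize l ≤ l.length * (N + 1) + 1 := by
  induction l with
  | nil => simp [tsize_nil]
  | cons a l ih =>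
    have ha := h a List.mem_cons_self
    have hl := ih fun b hb => h b (List.mem_cons_of_mem _ hb)
    rw [tsize_cons, List.length_cons, Nat.succ_mul]
    omega

theorem tsize_le_of_sublist {l l' : List α} (h : l.Sublist l') : tsize l ≤ tsize l' := by
  induction h with
  | slnil => rfl
  | cons a _ ih => rw [tsize_cons]; omega
  | cons_cons a _ ih => rw [tsize_cons, tsize_cons]; omega

theorem tsize_le_of_mem {a : α} {l : List α} (h : a ∈ l) : tsize a ≤ tsize l := by
  have := tsize_le_of_sublist (List.singleton_sublist.2 h)
  rw [tsize_cons] at this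
  omega

namespace PolyTimeIn

variable {B : α → ℕ}

theorem tsize_input {f : α → β} (hf : PolyTimeIn B f) : IsPolyBounded B tsize := by
  obtain ⟨p, t, ht, h⟩ := hf
  exact ht.mono fun a => (h a).size_le.1

theorem tsize_output {f : α → β} (hf : PolyTimeIn B f) :
    IsPolyBounded B fun a => tsize (f a) := by
  obtain ⟨p, t, ht, h⟩ := hf
  exact ht.mono fun a => (h a).size_le.2

theorem comp {C : β → ℕ} {g : β → γ} {f : α → β} (hg : PolyTimeIn C g) (hf : PolyTimeIn B f)
    (hC : IsPolyBounded B fun a => C (f a)) : PolyTimeIn B fun a => g (f a) := by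
  obtain ⟨p, s, hs, hp⟩ := hf
  obtain ⟨q, t, ht, hq⟩ := hg
  exact ⟨.comp q p, fun a => s a + t (f a) + 1, (hs.add (ht.comp hC)).add (.const _ 1),
    fun a => .comp (hp a) (hq (f a))⟩

theorem pair {f : α → β} {g : α → γ} (hf : PolyTimeIn B f) (hg : PolyTimeIn B g) :
    PolyTimeIn B fun a => (f a, g a) := by
  have hB := hf.tsize_input
  obtain ⟨p, s, hs, hp⟩ := hf
  obtain ⟨q, t, ht, hq⟩ := hg
  exact ⟨.pair p q, fun a => s a + t a + tsize a + 1, ((hs.add ht).add hB).add (.const _ 1),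
    fun a => .pair (hp a) (hq a)⟩

end PolyTimeIn

namespace PolyTime

theorem polyTimeIn {f : α → β} (hf : PolyTime f) {B : α → ℕ} (hB : IsPolyBounded B tsize) :
    PolyTimeIn B f := by
  obtain ⟨p, t, ht, h⟩ := hf
  exact ⟨p, t, ht.comp hB, h⟩

theorem comp_polyTimeIn {B : α → ℕ} {g : β → γ} {f : α → β} (hg : PolyTime g)
    (hf : PolyTimeIn B f) : PolyTimeIn B fun a => g (f a) :=
  PolyTimeIn.comp hg hf hf.tsize_output

@[fun_prop]
theorem comp {g : β → γ} {f : α → β} (hg : PolyTime g) (hf : PolyTime f) :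
    PolyTime fun a => g (f a) :=
  hg.comp_polyTimeIn hf

@[fun_prop]
theorem pair {f : α → β} {g : α → γ} (hf : PolyTime f) (hg : PolyTime g) :
    PolyTime fun a => (f a, g a) :=
  PolyTimeIn.pair hf hg

theorem of_enc_eq {f : α → β} {g : γ → δ} (hf : PolyTime f) (i : γ → α)
    (hi : ∀ c, enc c = enc (i c)) (hg : ∀ c, enc (g c) = enc (f (i c))) : PolyTime g := by
  obtain ⟨p, t, ht, h⟩ := hf
  refine ⟨p, fun c => t (i c), ht.comp ((IsPolyBounded.refl _).mono fun c => ?_), fun c => ?_⟩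
  · rw [tsize, tsize, hi]
  · rw [hi, hg]
    exact h (i c)

theorem of_eq {f g : α → β} (hf : PolyTime f) (h : ∀ a, f a = g a) : PolyTime g := by
  rwa [← funext h]

theorem of_runs_size {f : α → β} (p : Prog) (h : ∀ a, p.Runs (enc a) (enc (f a)) (tsize a + 1)) :
    PolyTime f :=
  ⟨p, fun a => tsize a + 1, (IsPolyBounded.refl _).add (.const _ 1), h⟩

@[fun_prop]
theorem id : PolyTime fun a : α => a :=
  of_runs_size .id fun a => .id (enc a)

@[fun_prop]
theorem fst : PolyTime fun p : α × β => p.1 :=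
  of_runs_size .fst fun p => .fst_cons (enc p.1) (enc p.2)

@[fun_prop]
theorem snd : PolyTime fun p : α × β => p.2 :=
  of_runs_size .snd fun p => .snd_cons (enc p.1) (enc p.2)

@[fun_prop]
theorem tail {l : α → List τ} (hl : PolyTime l) : PolyTime fun a => (l a).tail := by
  have : PolyTime fun l : List τ => l.tail := of_runs_size .snd fun
    | [] => .snd_nil
    | x :: l => .snd_cons (enc x) (enc l)
  exact this.comp hl

@[fun_prop]
theorem const (b : β) : PolyTime fun _ : α => b := by
  suffices h : ∀ y : BTree, PolyTime fun _ : α => y from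
    (h (enc b)).of_enc_eq (fun a => a) (fun _ => rfl) fun _ => rfl
  intro y
  induction y with
  | nil => exact of_runs_size .nil fun a => .nil (enc a)
  | cons y z hy hz => exact (hy.pair hz).of_enc_eq (fun a => a) (fun _ => rfl) fun _ => rfl

@[fun_prop]
theorem cons {f : α → β} {g : α → List β} (hf : PolyTime f) (hg : PolyTime g) :
    PolyTime fun a => f a :: g a :=
  (hf.pair hg).of_enc_eq (fun a => a) (fun _ => rfl) fun _ => rfl

@[fun_prop]
theorem left : PolyTime BTree.left :=
  of_runs_size .fst fun
    | .nil => .fst_nil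
    | .cons a b => .fst_cons a b

@[fun_prop]
theorem right : PolyTime BTree.right :=
  of_runs_size .snd fun
    | .nil => .snd_nil
    | .cons a b => .snd_cons a b

theorem ite_isCons {o : α → BTree} {f g : α → β} (ho : PolyTime o) (hf : PolyTime f)
    (hg : PolyTime g) : PolyTime fun a => if (o a).isCons then f a else g a := by
  obtain ⟨c, u, hu, hc⟩ := ho
  obtain ⟨p, s, hs, hp⟩ := hf
  obtain ⟨q, t, ht, hq⟩ := hg
  have hst : IsPolyBounded tsize fun a => if (o a).isCons then s a else t a :=
    (hs.add ht).mono fun a => by split <;> omega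
  refine ⟨.branch c p q, fun a => u a + (if (o a).isCons then s a else t a) + tsize a + 1,
    ((hu.add hst).add (.refl _)).add (.const _ 1), fun a => ?_⟩
  have hc : c.Runs (enc a) (o a) (u a) := hc a
  cases hoa : o a with
  | nil =>
    rw [hoa] at hc
    simp only [hoa, BTree.isCons, Bool.false_eq_true, if_false]
    exact .branch_false hc (hq a)
  | cons x y =>
    rw [hoa] at hc
    simp only [hoa, BTree.isCons, if_true]
    exact .branch_true hc (hp a)

@[fun_prop]
theorem isCons : PolyTime BTree.isCons :=
  (id.ite_isCons (const true) (const false)).of_eq fun t => by cases t <;> rfl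

@[fun_prop]
theorem ite {c : α → Prop} [DecidablePred c] {f g : α → β} (hc : PolyTime fun a => decide (c a))
    (hf : PolyTime f) (hg : PolyTime g) : PolyTime fun a => if c a then f a else g a :=
  (ite_isCons (o := fun a => enc (decide (c a)))
    (hc.of_enc_eq (fun a => a) (fun _ => rfl) fun _ => rfl) hf hg).of_eq fun a => by
      by_cases h : c a <;> simp [h, enc, encBool, BTree.isCons]

@[fun_prop]
theorem isEmpty {l : α → List τ} (hl : PolyTime l) : PolyTime fun a => (l a).isEmpty := by
  have : PolyTime fun l : List τ => l.isEmpty :=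
    ((isCons.ite_isCons (const false) (const true)).of_enc_eq enc (fun _ => rfl) fun
      | [] => rfl
      | _ :: _ => rfl)
  exact this.comp hl

@[fun_prop]
theorem headD {l : α → List τ} {d : α → τ} (hl : PolyTime l) (hd : PolyTime d) :
    PolyTime fun a => (l a).headD (d a) := by
  have hlt : PolyTime fun a => enc (l a) := hl.of_enc_eq (fun a => a) (fun _ => rfl) fun _ => rfl
  have hdt : PolyTime fun a => enc (d a) := hd.of_enc_eq (fun a => a) (fun _ => rfl) fun _ => rfl
  refine (hlt.ite_isCons (left.comp hlt) hdt).of_enc_eq (fun a => a) (fun _ => rfl) fun a => ?_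
  cases l a <;> rfl

@[fun_prop]
theorem and {f g : α → Bool} (hf : PolyTime f) (hg : PolyTime g) :
    PolyTime fun a => f a && g a :=
  (ite (c := fun a => f a) (by simpa using hf) hg (const false)).of_eq fun a => by
    cases f a <;> simp

@[fun_prop]
theorem not {f : α → Bool} (hf : PolyTime f) : PolyTime fun a => !f a :=
  (ite (c := fun a => f a) (by simpa using hf) (const false) (const true)).of_eq fun a => by
    cases f a <;> simp

@[fun_prop]
theorem or {f g : α → Bool} (hf : PolyTime f) (hg : PolyTime g) :
    PolyTime fun a => f a || g a :=
  (hf.not.and hg.not).not.of_eq fun a => by simp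

@[fun_prop]
theorem xor {f g : α → Bool} (hf : PolyTime f) (hg : PolyTime g) :
    PolyTime fun a => f a ^^ g a :=
  ((hf.and hg.not).or (hf.not.and hg)).of_eq fun a => by cases f a <;> simp

@[fun_prop]
theorem decide_eq_true {f : α → Bool} (hf : PolyTime f) :
    PolyTime fun a => decide (f a = true) :=
  hf.of_eq fun a => by simp

@[fun_prop]
theorem decide_and {c d : α → Prop} [DecidablePred c] [DecidablePred d]
    (hc : PolyTime fun a => decide (c a)) (hd : PolyTime fun a => decide (d a)) :
    PolyTime fun a => decide (c a ∧ d a) :=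
  (hc.and hd).of_eq fun a => by simp

@[fun_prop]
theorem decide_not {c : α → Prop} [DecidablePred c] (hc : PolyTime fun a => decide (c a)) :
    PolyTime fun a => decide (¬c a) :=
  hc.not.of_eq fun a => by simp

end PolyTime

-- The loop runs on triples of parameters, state and remaining list; this list is its condition.
theorem exists_loop_runs {f : α → σ → τ → σ} {c b : Prog} {T : ℕ → ℕ} (hT : Monotone T)
    (hc : ∀ x : α × σ × List τ, ∃ t ≤ T (tsize x), c.Runs (enc x) (enc x.2.2) t)
    (hb : ∀ a s x l, ∃ t ≤ T (tsize (a, s, x :: l)),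
      b.Runs (enc (a, s, x :: l)) (enc (a, f a s x, l)) t)
    {N : ℕ} (a : α) (l : List τ) (s : σ)
    (hN : ∀ l₁ l₂, l₁ ++ l₂ = l → tsize (a, l₁.foldl (f a) s, l₂) ≤ N) :
    ∃ t ≤ (l.length + 1) * (2 * T N + N + 1),
      (Prog.loop c b).Runs (enc (a, s, l)) (enc (a, l.foldl (f a) s, ([] : List τ))) t := by
  have hsize : tsize (a, s, l) ≤ N := hN [] l rfl
  obtain ⟨u, hu, hcond⟩ := hc (a, s, l)
  have hu' : u ≤ T N := hu.trans (hT hsize)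
  change (enc (a, s, l)).size ≤ N at hsize
  induction l generalizing s u with
  | nil =>
    exact ⟨_, by rw [List.length_nil]; omega, .loop_false hcond⟩
  | cons x l ih =>
    obtain ⟨v, hv, hbody⟩ := hb a s x l
    have hN' : ∀ l₁ l₂, l₁ ++ l₂ = l → tsize (a, l₁.foldl (f a) (f a s x), l₂) ≤ N :=
      fun l₁ l₂ h => hN (x :: l₁) l₂ (by rw [List.cons_append, h])
    have hnext : tsize (a, f a s x, l) ≤ N := hN' [] l rfl
    obtain ⟨u', hu', hcond'⟩ := hc (a, f a s x, l)
    obtain ⟨w, hw, hrest⟩ := ih (f a s x) hN' u' hu' hcond' (hu'.trans (hT hnext)) hnext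
    refine ⟨_, ?_, .loop_true hcond hbody hrest⟩
    have hv' : v ≤ T N := hv.trans (hT hsize)
    rw [List.length_cons, Nat.succ_mul]
    omega

theorem PolyTimeIn.foldl {B S : α → ℕ} {l : α → List τ} {i : α → σ} {f : α → σ → τ → σ}
    (hl : PolyTimeIn B l) (hi : PolyTimeIn B i)
    (hf : PolyTime fun p : α × σ × τ => f p.1 p.2.1 p.2.2) (hS : IsPolyBounded B S)
    (hfS : ∀ a l', l' <+: l a → tsize (l'.foldl (f a) (i a)) ≤ S a) :
    PolyTimeIn B fun a => (l a).foldl (f a) (i a) := by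
  obtain ⟨c, tc, ⟨C, hC⟩, hc⟩ : PolyTime fun x : α × σ × List τ => x.2.2 := by fun_prop
  obtain ⟨b, tb, ⟨D, hD⟩, hb⟩ : PolyTime fun x : α × σ × τ × List τ =>
      (x.1, f x.1 x.2.1 x.2.2.1, x.2.2.2) := by fun_prop
  obtain ⟨p, s, hs, hp⟩ := (PolyTime.id.polyTimeIn hl.tsize_input).pair (hi.pair hl)
  have hT : Monotone (C + D).eval := fun m n h => eval_le_eval _ h
  have hloop : ∀ a, ∃ t ≤ _, (Prog.loop c b).Runs _ _ t := fun a =>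
    exists_loop_runs (N := tsize a + S a + tsize (l a) + 2) hT
      (fun x => ⟨_, (hC x).trans (by simp), hc x⟩)
      (fun a s x l => ⟨_, (hD (a, s, x, l)).trans (by rw [Polynomial.eval_add]; exact le_add_self),
        hb (a, s, x, l)⟩) a (l a) (i a) fun l₁ l₂ h => by
        have h₁ := hfS a l₁ ⟨l₂, h⟩
        have h₂ := tsize_le_of_sublist (h ▸ List.sublist_append_right l₁ l₂ : l₂.Sublist (l a))
        simp only [tsize_pair]
        omega
  choose t ht hrun using hloop
  have hN : IsPolyBounded B fun a => tsize a + S a + tsize (l a) + 2 :=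
    ((hl.tsize_input.add hS).add hl.tsize_output).add (.const _ 2)
  have ht' : IsPolyBounded B t := by
    refine IsPolyBounded.mono ?_ ht
    exact ((hl.tsize_output.mono fun a => length_lt_tsize (l a)).mul
      ((((IsPolyBounded.const B 2).mul (hN.eval (C + D))).add hN).add (.const B 1)))
  have : PolyTimeIn B fun a => (a, (l a).foldl (f a) (i a), ([] : List τ)) :=
    ⟨.comp (.loop c b) p, fun a => s a + t a + 1, (hs.add ht').add (.const _ 1),
      fun a => .comp (hp a) (hrun a)⟩
  exact PolyTime.comp_polyTimeIn (g := fun x : α × σ × List τ => x.2.1) (by fun_prop) this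

theorem tsize_foldl_le {ι : Type} {f : σ → ι → σ} {N : ℕ} {l : List ι}
    (hf : ∀ s, ∀ x ∈ l, tsize (f s x) ≤ tsize s + N) (s : σ) :
    tsize (l.foldl f s) ≤ tsize s + l.length * N := by
  induction l generalizing s with
  | nil => simp
  | cons x l ih =>
    have h₁ := hf s x List.mem_cons_self
    have h₂ := ih (fun s y hy => hf s y (List.mem_cons_of_mem _ hy)) (f s x)
    rw [List.foldl_cons, List.length_cons, Nat.succ_mul]
    omega

theorem PolyTime.foldl {G : α × τ → ℕ} {l : α → List τ} {i : α → σ} {f : α → σ → τ → σ}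
    (hl : PolyTime l) (hi : PolyTime i) (hf : PolyTime fun p : α × σ × τ => f p.1 p.2.1 p.2.2)
    (hG : IsPolyBounded tsize G) (hfG : ∀ a s x, tsize (f a s x) ≤ tsize s + G (a, x)) :
    PolyTime fun a => (l a).foldl (f a) (i a) := by
  obtain ⟨P, hP⟩ := hG
  have hR : IsPolyBounded tsize fun a => tsize a + tsize (l a) + 1 :=
    ((IsPolyBounded.refl _).add hl.tsize_output).add (.const _ 1)
  refine PolyTimeIn.foldl hl hi hf
    (S := fun a => tsize (i a) + tsize (l a) * P.eval (tsize a + tsize (l a) + 1))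
    (hi.tsize_output.add (hl.tsize_output.mul (hR.eval P))) fun a l' hl' => ?_
  have hstep : ∀ s, ∀ x ∈ l', tsize (f a s x) ≤
      tsize s + P.eval (tsize a + tsize (l a) + 1) := fun s x hx => by
    refine (hfG a s x).trans (Nat.add_le_add_left ((hP (a, x)).trans (eval_le_eval P ?_)) _)
    have := tsize_le_of_mem (hl'.subset hx)
    rw [tsize_pair]
    omega
  refine (tsize_foldl_le hstep (i a)).trans (Nat.add_le_add_left (Nat.mul_le_mul_right _ ?_) _)
  exact hl'.length_le.trans (length_lt_tsize _).le

end

/-! ### Polynomial-time operations on lists and numbers -/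

/-- Equality of elements can be decided in polynomial time. -/
class PolyEq (α : Type) [TreeEnc α] [DecidableEq α] : Prop where
  polyTime_decide_eq : PolyTime fun p : α × α => decide (p.1 = p.2)

section

variable {α β τ : Type} [TreeEnc α] [TreeEnc β] [TreeEnc τ]

namespace PolyTime

@[fun_prop]
theorem reverse {l : α → List τ} (hl : PolyTime l) : PolyTime fun a => (l a).reverse :=
  (hl.foldl (f := fun _ s x => x :: s) (G := tsize) (const []) (by fun_prop) (.refl _)
    fun a s x => by simp only [tsize_cons, tsize_pair]; omega).of_eq fun a => by simp

@[fun_prop]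
theorem append {l l' : α → List τ} (hl : PolyTime l) (hl' : PolyTime l') :
    PolyTime fun a => l a ++ l' a :=
  (hl.reverse.foldl (f := fun _ s x => x :: s) (G := tsize) hl' (by fun_prop) (.refl _)
    fun a s x => by simp only [tsize_cons, tsize_pair]; omega).of_eq fun a => by simp

@[fun_prop]
theorem flatMap {l : α → List τ} {f : α → τ → List β} (hl : PolyTime l)
    (hf : PolyTime fun p : α × τ => f p.1 p.2) : PolyTime fun a => (l a).flatMap (f a) :=
  (hl.foldl (f := fun a s x => s ++ f a x) (const []) (by fun_prop) hf.tsize_output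
    fun a s x => by have := tsize_append s (f a x); dsimp only; omega).of_eq
      fun a => by rw [List.flatMap_eq_foldl]

@[fun_prop]
theorem map {l : α → List τ} {f : α → τ → β} (hl : PolyTime l)
    (hf : PolyTime fun p : α × τ => f p.1 p.2) : PolyTime fun a => (l a).map (f a) :=
  (hl.flatMap (f := fun a x => [f a x]) (by fun_prop)).of_eq fun a => by
    rw [List.map_eq_flatMap]

@[fun_prop]
theorem filter {l : α → List τ} {f : α → τ → Bool} (hl : PolyTime l)
    (hf : PolyTime fun p : α × τ => f p.1 p.2) : PolyTime fun a => (l a).filter (f a) :=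
  (hl.flatMap (f := fun a x => if f a x then [x] else []) (by fun_prop)).of_eq fun a => by
    induction l a with
    | nil => rfl
    | cons x l ih => cases h : f a x <;> simp_all

@[fun_prop]
theorem any {l : α → List τ} {f : α → τ → Bool} (hl : PolyTime l)
    (hf : PolyTime fun p : α × τ => f p.1 p.2) : PolyTime fun a => (l a).any (f a) :=
  (hl.filter hf).isEmpty.not.of_eq fun a => by
    induction l a with
    | nil => rfl
    | cons x l ih => cases h : f a x <;> simp_all

@[fun_prop]
theorem drop_length {l : α → List τ} {l' : α → List β} (hl : PolyTime l) (hl' : PolyTime l') :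
    PolyTime fun a => (l a).drop (l' a).length := by
  have hdrop : ∀ (l' : List β) (l : List τ),
      l'.foldl (fun s _ => s.tail) l = l.drop l'.length := fun l' => by
    induction l' with
    | nil => simp
    | cons x l' ih => intro l; simp [ih]
  exact (hl'.foldl (f := fun _ s _ => s.tail) (G := fun _ => 0) hl (by fun_prop) (.const _ 0)
    fun _ s _ => tsize_le_of_sublist s.tail_sublist).of_eq fun a => hdrop (l' a) (l a)

@[fun_prop]
theorem decide_eq [DecidableEq β] [PolyEq β] {f g : α → β} (hf : PolyTime f) (hg : PolyTime g) :
    PolyTime fun a => decide (f a = g a) :=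
  PolyEq.polyTime_decide_eq.comp (hf.pair hg)

@[fun_prop]
theorem decide_mem [DecidableEq β] [PolyEq β] {x : α → β} {l : α → List β} (hx : PolyTime x)
    (hl : PolyTime l) : PolyTime fun a => decide (x a ∈ l a) :=
  (hl.any (f := fun a y => decide (x a = y)) (by fun_prop)).of_eq fun a => by
    rw [Bool.eq_iff_iff]; simp

end PolyTime

namespace PolyEq

instance : PolyEq Bool where
  polyTime_decide_eq :=
    (PolyTime.fst.xor PolyTime.snd).not.of_eq fun p => by cases p.1 <;> cases p.2 <;> rfl

instance [DecidableEq α] [DecidableEq β] [PolyEq α] [PolyEq β] : PolyEq (α × β) where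
  polyTime_decide_eq := by
    have : PolyTime fun p : (α × β) × α × β => decide (p.1.1 = p.2.1 ∧ p.1.2 = p.2.2) := by
      fun_prop
    exact this.of_eq fun p => by simp [Prod.ext_iff]

instance [DecidableEq α] [PolyEq α] : PolyEq (List α) where
  polyTime_decide_eq := by
    let step (s : Bool × List α) (x : α) : Bool × List α :=
      (s.1 && (!s.2.isEmpty && decide (x = s.2.headD x)), s.2.tail)
    have hstep : PolyTime fun p : (List α × List α) × (Bool × List α) × α => step p.2.1 p.2.2 := by
      fun_prop
    have hfold : PolyTime fun p : List α × List α => p.1.foldl step (true, p.2) :=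
      PolyTime.fst.foldl (f := fun _ => step) (G := fun _ => 3) (by fun_prop) hstep (.const _ 3)
        fun _ s x => by
          have h₁ := tsize_bool_le (s.1 && (!s.2.isEmpty && decide (x = s.2.headD x)))
          have h₂ := tsize_le_of_sublist s.2.tail_sublist
          have h₃ : tsize s = tsize s.1 + tsize s.2 + 1 := rfl
          simp only [step, tsize_pair]
          omega
    have hspec : ∀ (l l' : List α) (b : Bool),
        ((l.foldl step (b, l')).1 && (l.foldl step (b, l')).2.isEmpty) = true ↔
          b = true ∧ l = l' := by
      intro l
      induction l with
      | nil => intro l' b; cases l' <;> simp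
      | cons x l ih =>
        intro l' b
        rw [List.foldl_cons, ih]
        cases l' <;> simp [and_assoc]
    have : PolyTime fun p : List α × List α =>
        ((p.1.foldl step (true, p.2)).1 && (p.1.foldl step (true, p.2)).2.isEmpty) := by fun_prop
    exact this.of_eq fun p => by rw [Bool.eq_iff_iff, hspec, decide_eq_true_iff]; simp

instance : PolyEq ℕ where
  polyTime_decide_eq :=
    PolyTime.of_enc_eq PolyEq.polyTime_decide_eq (fun p : ℕ × ℕ => (p.1.bits, p.2.bits))
      (fun _ => rfl) fun p => by
        have : p.1.bits = p.2.bits ↔ p.1 = p.2 :=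
          ⟨fun h => encNat_injective (by rw [encNat, encNat, h]), fun h => by rw [h]⟩
        simp [this]

end PolyEq

end

/-- The binary digits of `n + 1` in terms of those of `n`, the least significant one first. -/
def incBits : List Bool → List Bool
  | [] => [true]
  | false :: l => true :: l
  | true :: l => false :: incBits l

theorem bits_succ (n : ℕ) : (n + 1).bits = incBits n.bits := by
  induction n using Nat.strong_induction_on with
  | _ n ih =>
    obtain ⟨m, rfl | rfl⟩ := Nat.even_or_odd' n
    · rcases Nat.eq_zero_or_pos m with rfl | hm
      · simp [incBits]
      · rw [Nat.bit1_bits, Nat.bit0_bits m hm.ne', incBits]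
    · rw [show 2 * m + 1 + 1 = 2 * (m + 1) by ring, Nat.bit0_bits _ (by omega), Nat.bit1_bits,
        incBits, ih m (by omega)]

theorem tsize_incBits_le (l : List Bool) : tsize (incBits l) ≤ tsize l + 4 := by
  have h₁ : tsize false = 1 := rfl
  have h₂ : tsize true = 3 := rfl
  induction l with
  | nil => simp [incBits, tsize_nil, tsize_cons, h₂]
  | cons b l ih => cases b <;> simp only [incBits, tsize_cons] <;> omega

theorem tsize_succ_le (n : ℕ) : tsize (n + 1) ≤ tsize n + 4 := by
  have h := tsize_incBits_le n.bits
  rwa [← bits_succ] at h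

theorem tsize_nat_le (n : ℕ) : tsize n ≤ 4 * n + 1 := by
  induction n with
  | zero => simp [tsize, enc, encNat, encList, BTree.size]
  | succ n ih => have := tsize_succ_le n; omega

section

variable {α τ : Type} [TreeEnc α] [TreeEnc τ]

-- The state of the loop is the carry and the reversed list of the new digits.
theorem polyTime_incBits : PolyTime incBits := by
  let step (s : Bool × List Bool) (b : Bool) : Bool × List Bool := (s.1 && b, (s.1 ^^ b) :: s.2)
  let finish (s : Bool × List Bool) : List Bool := (if s.1 then true :: s.2 else s.2).reverse
  have hspec : ∀ (l out : List Bool) (c : Bool), finish (l.foldl step (c, out)) =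
      out.reverse ++ if c then incBits l else l := fun l => by
    induction l with
    | nil => intro out c; cases c <;> simp [finish, incBits]
    | cons b l ih => intro out c; rw [List.foldl_cons, ih]; cases c <;> cases b <;> simp [incBits]
  have hstep : PolyTime fun p : List Bool × (Bool × List Bool) × Bool => step p.2.1 p.2.2 := by
    fun_prop
  have hfold : PolyTime fun l : List Bool => l.foldl step (true, []) :=
    PolyTime.foldl (f := fun _ => step) (G := fun _ => 7) .id (.const _) hstep (.const _ 7)
      fun _ s b => by
        have h₁ := tsize_bool_le (s.1 && b)
        have h₂ := tsize_bool_le (s.1 ^^ b)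
        have h₃ : tsize s = tsize s.1 + tsize s.2 + 1 := rfl
        simp only [step, tsize_pair, tsize_cons]
        omega
  have hfinish : PolyTime finish := by fun_prop
  exact (hfinish.comp hfold).of_eq fun l => by simp [hspec]

namespace PolyTime

@[fun_prop]
theorem succ {f : α → ℕ} (hf : PolyTime f) : PolyTime fun a => f a + 1 :=
  (polyTime_incBits.of_enc_eq (g := Nat.succ) Nat.bits (fun _ => rfl)
    fun n => by rw [← bits_succ]; rfl).comp hf

@[fun_prop]
theorem add_length {n : α → ℕ} {l : α → List τ} (hn : PolyTime n) (hl : PolyTime l) :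
    PolyTime fun a => n a + (l a).length := by
  refine (hl.foldl (f := fun _ n _ => n + 1) (G := fun _ => 4) hn (by fun_prop) (.const _ 4)
    fun _ n _ => tsize_succ_le n).of_eq fun a => ?_
  induction l a using List.reverseRecOn with
  | nil => rfl
  | append_singleton l x ih => rw [List.foldl_append, ih, List.length_append]; rfl

@[fun_prop]
theorem length {l : α → List τ} (hl : PolyTime l) : PolyTime fun a => (l a).length :=
  ((const 0).add_length hl).of_eq fun _ => zero_add _

@[fun_prop]
theorem take {k : α → ℕ} {l : α → List τ} (hk : PolyTime k) (hl : PolyTime l) :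
    PolyTime fun a => (l a).take (k a) := by
  refine (hl.foldl (f := fun a s x => if s.length = k a then s else s ++ [x]) (G := tsize)
    (const []) (by fun_prop) (.refl _) fun a s x => ?_).of_eq fun a => ?_
  · have := tsize_append s [x]
    simp only [tsize_cons, tsize_nil, tsize_pair] at this ⊢
    split <;> omega
  · induction l a using List.reverseRecOn with
    | nil => simp
    | append_singleton l x ih =>
      rw [List.foldl_append, ih, List.foldl_cons, List.foldl_nil, List.length_take]
      split
      · rw [List.take_append_of_le_length (by omega)]
      · rw [List.take_of_length_le (by omega), List.take_of_length_le (by simp; omega)]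

@[fun_prop]
theorem drop {k : α → ℕ} {l : α → List τ} (hk : PolyTime k) (hl : PolyTime l) :
    PolyTime fun a => (l a).drop (k a) :=
  (hl.drop_length (hk.take hl)).of_eq fun a => by
    rw [List.length_take]
    rcases le_total (k a) (l a).length with h | h
    · rw [min_eq_left h]
    · rw [min_eq_right h, List.drop_length, List.drop_of_length_le h]

@[fun_prop]
theorem drop_mul (c : ℕ) {k : α → ℕ} {l : α → List τ} (hk : PolyTime k) (hl : PolyTime l) :
    PolyTime fun a => (l a).drop (c * k a) := by
  induction c with
  | zero => simpa using hl
  | succ c ih =>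
    simp only [Nat.succ_mul, ← List.drop_drop]
    fun_prop

@[fun_prop]
theorem decide_le_length {k : α → ℕ} {l : α → List τ} (hk : PolyTime k) (hl : PolyTime l) :
    PolyTime fun a => decide (k a ≤ (l a).length) :=
  ((hk.take hl).length.decide_eq hk).of_eq fun a => by
    simp [List.length_take]

@[fun_prop]
theorem decide_mul_lt_length (c : ℕ) {k : α → ℕ} {l : α → List τ} (hk : PolyTime k)
    (hl : PolyTime l) : PolyTime fun a => decide (c * k a < (l a).length) :=
  (hk.drop_mul c hl).isEmpty.not.of_eq fun a => by
    rw [Bool.eq_iff_iff]; simp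

@[fun_prop]
theorem dedup [DecidableEq τ] [PolyEq τ] {l : α → List τ} (hl : PolyTime l) :
    PolyTime fun a => (l a).dedup := by
  refine (hl.reverse.foldl (f := fun _ s x => if x ∈ s then s else x :: s) (G := tsize)
    (const []) (by fun_prop) (.refl _) fun a s x => ?_).of_eq fun a => ?_
  · simp only [tsize_pair]
    split
    · omega
    · rw [tsize_cons]; omega
  · rw [List.foldl_reverse]
    induction l a with
    | nil => rfl
    | cons x l ih => rw [List.foldr_cons, ih, List.dedup_cons']

@[fun_prop]
theorem idxOf [DecidableEq τ] [PolyEq τ] {x : α → τ} {l : α → List τ}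
    (hx : PolyTime x) (hl : PolyTime l) : PolyTime fun a => (l a).idxOf (x a) := by
  refine (hl.reverse.foldl (f := fun a n y => if y = x a then 0 else n + 1) (G := fun _ => 4)
    (const 0) (by fun_prop) (.const _ 4) fun a n y => ?_).of_eq fun a => ?_
  · have := tsize_succ_le n
    have := tsize_pos n
    have : tsize 0 = 1 := rfl
    split <;> omega
  · rw [List.foldl_reverse]
    induction l a with
    | nil => rfl
    | cons y l ih => rw [List.foldr_cons, ih, List.idxOf_cons]; simp [cond_eq_ite]

end PolyTime

end

/-! ### Isolated sets of characters -/

section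

variable {V : Type} [Fintype V]

/-- The nontrivial character of `ZMod 2`. -/
def sgn : AddChar (ZMod 2) ℤ := AddChar.zmodChar 2 (ζ := -1) (by norm_num)

/-- The Walsh character `x ↦ (-1) ^ (s ⬝ᵥ x)`. -/
def walsh (s : V → ZMod 2) : AddChar (V → ZMod 2) ℤ :=
  sgn.compAddMonoidHom (dotProductBilin (ZMod 2) (ZMod 2) s).toAddMonoidHom

theorem sgn_eq_ite (a : ZMod 2) : sgn a = if a = 0 then 1 else -1 := by
  revert a; decide

theorem walsh_apply (s x : V → ZMod 2) : walsh s x = sgn (s ⬝ᵥ x) := rfl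

theorem walsh_comm (s x : V → ZMod 2) : walsh s x = walsh x s := by
  rw [walsh_apply, walsh_apply, dotProduct_comm]

theorem abs_walsh (s x : V → ZMod 2) : |walsh s x| = 1 := by
  rw [walsh_apply, sgn_eq_ite]
  split_ifs <;> rfl

theorem walsh_add (s t x : V → ZMod 2) : walsh (s + t) x = walsh s x * walsh t x := by
  simp only [walsh_comm _ x, AddChar.map_add_eq_mul]

theorem walsh_zero (x : V → ZMod 2) : walsh 0 x = 1 := by
  rw [walsh_comm, AddChar.map_zero_eq_one]

theorem walsh_sum (J : Finset (V → ZMod 2)) (x : V → ZMod 2) :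
    walsh (∑ s ∈ J, s) x = ∏ s ∈ J, walsh s x := by
  classical
  induction J using Finset.induction_on with
  | empty => exact walsh_zero x
  | insert a J ha ih => rw [Finset.sum_insert ha, Finset.prod_insert ha, walsh_add, ih]

theorem sum_walsh [DecidableEq V] (s : V → ZMod 2) :
    ∑ x, walsh s x = if s = 0 then (2 : ℤ) ^ Fintype.card V else 0 := by
  split_ifs with hs
  · simp [hs, walsh_zero]
  · refine AddChar.sum_eq_zero_of_ne_one fun h => hs (funext fun i => ?_)
    have : sgn (s i) = 1 := by simpa [walsh_apply] using DFunLike.congr_fun h (Pi.single i 1)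
    by_contra hi
    rw [sgn_eq_ite, if_neg (by simpa using hi)] at this
    omega

theorem sum_sgn (z : V → ZMod 2) : ∑ v, sgn (z v) = Fintype.card V - 2 * hammingNorm z := by
  have : ∀ a : ZMod 2, sgn a = 1 - 2 * if a ≠ 0 then 1 else 0 := by decide
  simp only [this, Finset.sum_sub_distrib, ← Finset.mul_sum, Finset.sum_boole, hammingNorm]
  simp

section RieszProduct

/-- The Riesz product of a set of Walsh characters with signs (or vanishing coefficients) `ε`. -/
def rieszProduct (K : Finset (V → ZMod 2)) (ε : (V → ZMod 2) → ℤ) (x : V → ZMod 2) : ℤ :=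
  ∏ s ∈ K, (1 + ε s * walsh s x)

theorem rieszProduct_nonneg {K : Finset (V → ZMod 2)} {ε : (V → ZMod 2) → ℤ}
    (hε : ∀ s ∈ K, |ε s| ≤ 1) (x : V → ZMod 2) : 0 ≤ rieszProduct K ε x :=
  Finset.prod_nonneg fun s hs => by
    have : |ε s * walsh s x| ≤ 1 := by rw [abs_mul, abs_walsh, mul_one]; exact hε s hs
    linarith [neg_abs_le (ε s * walsh s x)]

theorem sum_walsh_mul_rieszProduct [DecidableEq V] (K : Finset (V → ZMod 2))
    (ε : (V → ZMod 2) → ℤ) (t : V → ZMod 2) : ∑ x, walsh t x * rieszProduct K ε x =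
      2 ^ Fintype.card V * ∑ J ∈ K.powerset with ∑ s ∈ J, s = t, ∏ s ∈ J, ε s := by
  have hexpand : ∀ x, walsh t x * rieszProduct K ε x =
      ∑ J ∈ K.powerset, (∏ s ∈ J, ε s) * walsh (t + ∑ s ∈ J, s) x := fun x => by
    simp only [rieszProduct, Finset.prod_one_add, Finset.prod_mul_distrib, ← walsh_sum, walsh_add,
      Finset.mul_sum]
    exact Finset.sum_congr rfl fun J _ => mul_left_comm _ _ _
  have hzero : ∀ s : V → ZMod 2, t + s = 0 ↔ s = t := fun s => by
    rw [add_eq_zero_iff_eq_neg', ZModModule.neg_eq_self]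
  simp only [hexpand]
  rw [Finset.sum_comm]
  simp only [← Finset.mul_sum, sum_walsh, hzero, mul_ite, mul_zero, ← Finset.sum_filter,
    ← Finset.sum_mul]
  exact mul_comm _ _

variable {K : Finset (V → ZMod 2)} [DecidableEq V]

theorem sum_rieszProduct (hK : ∀ J ⊆ K, J.Nonempty → ∑ s ∈ J, s ≠ 0) (ε : (V → ZMod 2) → ℤ) :
    ∑ x, rieszProduct K ε x = 2 ^ Fintype.card V := by
  have h := sum_walsh_mul_rieszProduct K ε 0
  simp only [walsh_zero, one_mul] at h
  have hempty : {J ∈ K.powerset | ∑ s ∈ J, s = 0} = {∅} := by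
    ext J
    rw [Finset.mem_filter, Finset.mem_powerset, Finset.mem_singleton]
    refine ⟨fun ⟨hJ, h0⟩ => ?_, ?_⟩
    · by_contra hne
      exact hK J hJ (Finset.nonempty_iff_ne_empty.2 hne) h0
    · rintro rfl
      simp
  rw [h, hempty, Finset.sum_singleton, Finset.prod_empty, mul_one]

theorem sum_mul_rieszProduct {w : (V → ZMod 2) → ℤ}
    (hw : ∀ J ⊆ K, J.card ≠ 1 → w (∑ s ∈ J, s) = 0) (ε : (V → ZMod 2) → ℤ) :
    ∑ x, (∑ t, w t * walsh t x) * rieszProduct K ε x =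
      2 ^ Fintype.card V * ∑ s ∈ K, w s * ε s := by
  calc ∑ x, (∑ t, w t * walsh t x) * rieszProduct K ε x
      = ∑ t, w t * ∑ x, walsh t x * rieszProduct K ε x := by
        simp only [Finset.sum_mul, Finset.mul_sum, mul_assoc]
        exact Finset.sum_comm
    _ = 2 ^ Fintype.card V * ∑ J ∈ K.powerset, w (∑ s ∈ J, s) * ∏ s ∈ J, ε s := by
        simp only [sum_walsh_mul_rieszProduct, mul_left_comm (w _), ← Finset.mul_sum]
        simp only [Finset.mul_sum, Finset.sum_filter, mul_ite, mul_zero]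
        rw [Finset.sum_comm]
        simp
    _ = 2 ^ Fintype.card V * ∑ J ∈ K.powersetCard 1, w (∑ s ∈ J, s) * ∏ s ∈ J, ε s := by
        congr 1
        refine (Finset.sum_subset (fun J hJ => ?_) fun J hJ hJ' => ?_).symm
        · exact Finset.mem_powerset.2 (Finset.mem_powersetCard.1 hJ).1
        · rw [Finset.mem_powerset] at hJ
          rw [hw J hJ fun h => hJ' (Finset.mem_powersetCard.2 ⟨hJ, h⟩), zero_mul]
    _ = 2 ^ Fintype.card V * ∑ s ∈ K, w s * ε s := by
        simp [Finset.powersetCard_one]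

theorem exists_sum_abs_le {w : (V → ZMod 2) → ℤ} (hK : ∀ J ⊆ K, J.Nonempty → ∑ s ∈ J, s ≠ 0)
    (hw : ∀ J ⊆ K, J.card ≠ 1 → w (∑ s ∈ J, s) = 0) :
    ∃ x, ∑ s ∈ K, |w s| ≤ ∑ t, w t * walsh t x := by
  by_contra! hlt
  let ε (s : V → ZMod 2) : ℤ := (w s).sign
  have hρ : ∀ x, 0 ≤ rieszProduct K ε x := rieszProduct_nonneg fun s _ => by
    rcases eq_or_ne (w s) 0 with h | h
    · simp [ε, h]
    · exact (Int.abs_sign_of_ne_zero h).le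
  have hmass := sum_rieszProduct hK ε
  have hpos : ∃ x ∈ Finset.univ, rieszProduct K ε x ≠ 0 :=
    Finset.exists_ne_zero_of_sum_ne_zero (by rw [hmass]; positivity)
  obtain ⟨x₀, -, hx₀⟩ := hpos
  have hmean : ∑ x, (∑ t, w t * walsh t x) * rieszProduct K ε x <
      ∑ x, (∑ s ∈ K, |w s|) * rieszProduct K ε x :=
    Finset.sum_lt_sum (fun x _ => mul_le_mul_of_nonneg_right (hlt x).le (hρ x))
      ⟨x₀, Finset.mem_univ _, mul_lt_mul_of_pos_right (hlt x₀) ((hρ x₀).lt_of_ne' hx₀)⟩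
  rw [sum_mul_rieszProduct hw, ← Finset.mul_sum, hmass, mul_comm] at hmean
  simp only [ε, mul_comm (w _), Int.sign_mul_self_eq_abs, lt_self_iff_false] at hmean

theorem exists_abs_le {w : (V → ZMod 2) → ℤ} (hw : w 0 = 0) {s : V → ZMod 2} (hs : s ≠ 0) :
    ∃ x, |w s| ≤ ∑ t, w t * walsh t x := by
  simpa using exists_sum_abs_le (K := {s}) (w := w)
    (fun J hJ hne => by
      rw [(Finset.subset_singleton_iff.1 hJ).resolve_left hne.ne_empty, Finset.sum_singleton]
      exact hs)
    fun J hJ hc => by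
      rcases Finset.subset_singleton_iff.1 hJ with rfl | rfl
      · exact hw
      · simp at hc

end RieszProduct

-- A subset of minimal cardinality with the given sum works.
theorem exists_subset_sum_eq_of_minimal {A : Type*} [AddCommGroup A] [Module (ZMod 2) A]
    {M K₀ : Finset A} (hK₀ : K₀ ⊆ M) : ∃ K ⊆ M, ∑ a ∈ K, a = ∑ a ∈ K₀, a ∧
      (∀ J ⊆ K, J.Nonempty → ∑ a ∈ J, a ≠ 0) ∧ ∀ J ⊆ K, 2 ≤ J.card → ∑ a ∈ J, a ∉ M := by
  classical
  obtain ⟨K, hK, hmin⟩ := Finset.exists_min_image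
    {K ∈ M.powerset | ∑ a ∈ K, a = ∑ a ∈ K₀, a} Finset.card ⟨K₀, by simp [hK₀]⟩
  simp only [Finset.mem_filter, Finset.mem_powerset, and_imp] at hK hmin
  have hsdiff : ∀ J ⊆ K, K \ J ⊆ M ∧ (K \ J).card + J.card = K.card ∧
      ∑ a ∈ K \ J, a + ∑ a ∈ J, a = ∑ a ∈ K₀, a := fun J hJ =>
    ⟨Finset.sdiff_subset.trans hK.1, Finset.card_sdiff_add_card_eq_card hJ,
      by rw [Finset.sum_sdiff hJ, hK.2]⟩
  refine ⟨K, hK.1, hK.2, fun J hJ hne h0 => ?_, fun J hJ hc hM => ?_⟩ <;>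
    obtain ⟨hsub, hcard, hsum⟩ := hsdiff J hJ
  · rw [h0, add_zero] at hsum
    have := hmin _ hsub hsum
    have := hne.card_pos
    omega
  · by_cases hm : ∑ a ∈ J, a ∈ K \ J
    · rw [← Finset.sum_erase_add _ _ hm, add_assoc, ZModModule.add_self, add_zero] at hsum
      have := hmin _ ((Finset.erase_subset _ _).trans hsub) hsum
      have := Finset.card_erase_le (s := K \ J) (a := ∑ a ∈ J, a)
      omega
    · rw [add_comm, ← Finset.sum_insert (f := fun a => a) hm] at hsum
      have := hmin _ (Finset.insert_subset hM hsub) hsum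
      rw [Finset.card_insert_of_notMem hm] at this
      omega

theorem hammingNorm_sum_le {A ι : Type*} [AddCommMonoid A] [DecidableEq A] (K : Finset ι)
    (f : ι → V → A) : hammingNorm (∑ s ∈ K, f s) ≤ ∑ s ∈ K, hammingNorm (f s) := by
  classical
  refine le_trans (Finset.card_le_card (t := K.biUnion fun s => {v | f s v ≠ 0}) fun v hv => ?_)
    Finset.card_biUnion_le
  rw [Finset.mem_filter, Finset.sum_apply] at hv
  simpa using Finset.exists_ne_zero_of_sum_ne_zero hv.2

-- A uniformly random subset sum is nonzero at each coordinate with probability one half.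
theorem exists_subset_card_le_two_mul_hammingNorm_sum {M : Finset (V → ZMod 2)}
    (hM : ∀ v, ∃ s ∈ M, s v ≠ 0) :
    ∃ K ⊆ M, Fintype.card V ≤ 2 * hammingNorm (∑ s ∈ K, s) := by
  classical
  let u (v : V) (s : M) : ZMod 2 := s.1 v
  have hu : ∀ v, u v ≠ 0 := fun v h => by
    obtain ⟨s, hs, hv⟩ := hM v
    exact hv (congrFun h ⟨s, hs⟩)
  have hmean : ∑ y, ∑ v, walsh (u v) y = 0 := by
    rw [Finset.sum_comm]
    exact Finset.sum_eq_zero fun v _ => by rw [sum_walsh, if_neg (hu v)]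
  obtain ⟨y, -, hy⟩ := Finset.exists_le_of_sum_le (s := Finset.univ)
    (f := fun y => ∑ v, walsh (u v) y) (g := fun _ => 0) Finset.univ_nonempty (by simp [hmean])
  have hsum : ∀ v, u v ⬝ᵥ y = (∑ s : M, if y s = 0 then 0 else s.1) v := fun v => by
    rw [Finset.sum_apply, dotProduct]
    refine Finset.sum_congr rfl fun s _ => ?_
    have hmul : ∀ a b : ZMod 2, a * b = if b = 0 then 0 else a := by decide
    rw [hmul]
    split_ifs <;> rfl
  simp only [walsh_apply, hsum, sum_sgn] at hy
  refine ⟨({s | y s ≠ 0} : Finset M).map (.subtype _), fun s hs => ?_, ?_⟩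
  · obtain ⟨s, -, rfl⟩ := Finset.mem_map.1 hs
    exact s.2
  · rw [Finset.sum_map, Finset.sum_filter]
    simp only [ne_eq, ite_not, Function.Embedding.coe_subtype]
    omega

theorem exists_le_of_lt_card [DecidableEq V] {w : (V → ZMod 2) → ℤ} (hw : w 0 = 0) {r k : ℕ}
    (hr : ∀ s, w s ≠ 0 → hammingNorm s ≤ r) (hV : ∀ v, ∃ s, w s ≠ 0 ∧ s v ≠ 0)
    (hk : 2 * r * k < Fintype.card V) : ∃ x, (k : ℤ) ≤ ∑ t, w t * walsh t x := by
  obtain ⟨K₀, hK₀, hnorm⟩ := exists_subset_card_le_two_mul_hammingNorm_sum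
    (M := {s | w s ≠ 0}) (by simpa using hV)
  obtain ⟨K, hKM, hsum, hfree, hmem⟩ := exists_subset_sum_eq_of_minimal hK₀
  have hKw : ∀ s ∈ K, w s ≠ 0 := fun s hs => by simpa using hKM hs
  obtain ⟨x, hx⟩ := exists_sum_abs_le (w := w) hfree fun J hJ hc => by
    rcases Nat.lt_or_ge J.card 2 with h | h
    · rw [Finset.card_eq_zero.1 (by omega : J.card = 0), Finset.sum_empty, hw]
    · simpa using hmem J hJ h
  have hcard : (K.card : ℤ) ≤ ∑ s ∈ K, |w s| := by
    simpa using Finset.card_nsmul_le_sum K (fun s => |w s|) 1 fun s hs =>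
      Int.one_le_abs (hKw s hs)
  have hnorm' : hammingNorm (∑ s ∈ K, s) ≤ K.card * r :=
    (hammingNorm_sum_le K _).trans (Finset.sum_le_card_nsmul _ _ r fun s hs => hr s (hKw s hs))
  rw [hsum] at hnorm'
  have hkK : k ≤ K.card := by
    by_contra! h
    have := Nat.mul_le_mul_right (2 * r) h.le
    nlinarith
  exact ⟨x, by omega⟩

end

/-! ### Equations and their excess -/

/-- The equation `∑ i ∈ vars, x i = rhs` over `𝔽₂`, as the pair `(vars, rhs)`. It stands also for
the signed character that is `1` where the equation holds and `-1` elsewhere. -/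
abbrev Equation (α : Type) := List α × ZMod 2

namespace Equation

variable {α : Type}

/-- The equation that is satisfied where `e` is falsified. -/
def flip (e : Equation α) : Equation α := (e.1, e.2 + 1)

/-- The contribution of an equation to the excess. -/
def val (x : α → ZMod 2) (e : Equation α) : ℤ := sgn (e.2 + (e.1.map x).sum)

/-- The number of satisfied equations minus the number of falsified ones. -/
def excess (x : α → ZMod 2) (T : List (Equation α)) : ℤ := (T.map (val x)).sum

/-- The Fourier expansion of `2 ^ d` times a Boolean function of at most `d` variables, which is
given by its truth table. Constants are equations without variables. -/
def expand : ℕ → BTree → List α → List (Equation α)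
  | 0, t, _ => if t.isCons then [([], 0)] else []
  | d + 1, t, [] => expand d t [] ++ expand d t []
  | d + 1, t, v :: vs =>
    (expand d t.left vs ++ expand d t.right vs) ++
      ((expand d t.left vs).map (fun e => (v :: e.1, e.2)) ++
        (expand d t.right vs).map fun e => (v :: e.1, e.2 + 1))

theorem flip_flip (e : Equation α) : e.flip.flip = e :=
  Prod.ext rfl (by rw [flip, flip, add_assoc, CharTwo.add_self_eq_zero, add_zero])

theorem sgn_add_one (a : ZMod 2) : sgn (a + 1) = -sgn a := by
  revert a; decide

theorem val_add_one (x : α → ZMod 2) (l : List α) (b : ZMod 2) :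
    val x (l, b + 1) = -val x (l, b) := by
  rw [val, val, add_right_comm, sgn_add_one]

theorem val_flip (x : α → ZMod 2) (e : Equation α) : val x e.flip = -val x e :=
  val_add_one x e.1 e.2

theorem val_cons (x : α → ZMod 2) (v : α) (l : List α) (b : ZMod 2) :
    val x (v :: l, b) = sgn (x v) * val x (l, b) := by
  rw [val, val, ← AddChar.map_add_eq_mul, List.map_cons, List.sum_cons, add_left_comm]

theorem val_congr {x y : α → ZMod 2} {e : Equation α} (h : ∀ v ∈ e.1, x v = y v) :
    val x e = val y e := by
  rw [val, val, List.map_congr_left h]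

theorem excess_append (x : α → ZMod 2) (T T' : List (Equation α)) :
    excess x (T ++ T') = excess x T + excess x T' := by
  simp [excess]

theorem excess_map_cons (x : α → ZMod 2) (v : α) (T : List (Equation α)) :
    excess x (T.map fun e => (v :: e.1, e.2)) = sgn (x v) * excess x T := by
  simp only [excess, List.map_map, ← List.sum_map_mul_left, Function.comp_def, val_cons]

theorem excess_map_cons_add_one (x : α → ZMod 2) (v : α) (T : List (Equation α)) :
    excess x (T.map fun e => (v :: e.1, e.2 + 1)) = -(sgn (x v) * excess x T) := by
  rw [← neg_mul]
  simp only [excess, List.map_map, ← List.sum_map_mul_left, Function.comp_def, val_cons,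
    val_add_one, neg_mul]

theorem excess_expand (x : α → ZMod 2) {d : ℕ} {vs : List α} (f : (Fin vs.length → Bool) → Bool)
    (hd : vs.length ≤ d) : excess x (expand d (encTable vs.length f) vs) =
      if f (fun j => decide (x (vs.get j) = 1)) then 2 ^ d else 0 := by
  induction d generalizing vs with
  | zero =>
    obtain rfl := List.eq_nil_of_length_eq_zero (Nat.le_zero.1 hd)
    rw [show (fun j => decide (x (([] : List α).get j) = 1)) = Fin.elim0 from
      funext fun j => j.elim0]
    cases h : f Fin.elim0 <;>
      simp [expand, encTable, h, encBool, BTree.isCons, excess, val]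
  | succ d ih =>
    cases vs with
    | nil =>
      rw [expand, excess_append, ih f d.zero_le]
      split_ifs <;> ring
    | cons v vs =>
      have hcons : (fun j : Fin (vs.length + 1) => decide (x ((v :: vs).get j) = 1)) =
          Fin.cons (decide (x v = 1)) fun j => decide (x (vs.get j) = 1) :=
        funext fun j => Fin.cases rfl (fun _ => rfl) j
      have hvs : vs.length ≤ d := Nat.le_of_succ_le_succ hd
      rw [expand, excess_append, excess_append, excess_append, excess_map_cons,
        excess_map_cons_add_one]
      simp only [List.length_cons, encTable, BTree.left, BTree.right, hcons, ih _ hvs]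
      have hx : x v = 0 ∨ x v = 1 := by generalize x v = a; revert a; decide
      rcases hx with hx | hx <;> simp only [hx, sgn_eq_ite] <;> simp <;> split_ifs <;> ring

theorem sublist_of_mem_expand {d : ℕ} {t : BTree} {vs : List α} {e : Equation α}
    (he : e ∈ expand d t vs) : e.1.Sublist vs := by
  induction d generalizing t vs e with
  | zero =>
    rw [expand] at he
    split_ifs at he <;> simp_all
  | succ d ih =>
    cases vs with
    | nil =>
      rw [expand, List.mem_append, or_self] at he
      exact ih he
    | cons v vs =>
      simp only [expand, List.mem_append, List.mem_map] at he
      rcases he with (he | he) | ⟨e', he, rfl⟩ | ⟨e', he, rfl⟩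
      · exact (ih he).cons v
      · exact (ih he).cons v
      · exact (ih he).cons_cons v
      · exact (ih he).cons_cons v

-- The signs of `e` and `e.flip` are opposite, hence only the odd part of a weight contributes.
theorem sum_mul_val_eq_of_sub_flip_eq {S : Finset (Equation α)} (hS : ∀ e ∈ S, e.flip ∈ S)
    {g h : Equation α → ℤ} (hgh : ∀ e ∈ S, g e - g e.flip = h e - h e.flip) (x : α → ZMod 2) :
    ∑ e ∈ S, g e * val x e = ∑ e ∈ S, h e * val x e := by
  have hflip : ∀ g : Equation α → ℤ,
      ∑ e ∈ S, (g e - g e.flip) * val x e = 2 * ∑ e ∈ S, g e * val x e := fun g => by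
    have : ∑ e ∈ S, g e.flip * val x e = -∑ e ∈ S, g e * val x e := by
      rw [← Finset.sum_neg_distrib]
      refine Finset.sum_nbij' flip flip hS hS (fun e _ => flip_flip e) (fun e _ => flip_flip e)
        fun e _ => ?_
      rw [val_flip, mul_neg, neg_neg]
    simp only [sub_mul, Finset.sum_sub_distrib, this]
    ring
  have := hflip g
  rw [Finset.sum_congr rfl fun e he => by rw [hgh e he], hflip h] at this
  omega

variable [DecidableEq α]

/-- The variables that occur in a list of equations. -/
def support (T : List (Equation α)) : List α := (T.flatMap fun e => e.1).dedup

/-- The equations with their variables listed in a common order, which makes left-hand sides that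
are equal as sets equal as lists. -/
def normalize (T : List (Equation α)) : List (Equation α) :=
  T.map fun e => ((support T).filter fun v => decide (v ∈ e.1), e.2)

/-- The multiplicity of an equation after the cancellation against the opposite equation (truncated
at `0`, so that at most one of the two remains). -/
def netCount (T : List (Equation α)) (e : Equation α) : ℕ := T.count e - T.count e.flip

/-- The equations that survive the cancellation. -/
def reduce (T : List (Equation α)) : List (Equation α) :=
  T.dedup.filter fun e => decide (netCount T e ≠ 0)

theorem netCount_eq_length_drop (T : List (Equation α)) (e : Equation α) :
    netCount T e = ((T.filter fun e' => decide (e' = e)).drop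
      (T.filter fun e' => decide (e' = e.flip)).length).length := by
  have hcount : ∀ e, T.count e = (T.filter fun e' => decide (e' = e)).length := fun e => by
    rw [List.count, List.countP_eq_length_filter]
    congr! 3
    exact beq_eq_decide _ _
  rw [netCount, hcount, hcount, List.length_drop]

theorem mem_support {T : List (Equation α)} {v : α} :
    v ∈ support T ↔ ∃ e ∈ T, v ∈ e.1 := by
  rw [support, List.mem_dedup, List.mem_flatMap]

theorem nodup_support (T : List (Equation α)) : (support T).Nodup :=
  List.nodup_dedup _

theorem perm_filter_support {T : List (Equation α)} {e : Equation α} (he : e ∈ T)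
    (hn : e.1.Nodup) : ((support T).filter fun v => decide (v ∈ e.1)).Perm e.1 := by
  rw [List.perm_ext_iff_of_nodup ((nodup_support T).filter _) hn]
  intro v
  rw [List.mem_filter, decide_eq_true_eq, and_iff_right_iff_imp]
  exact fun hv => mem_support.2 ⟨e, he, hv⟩

theorem exists_perm_of_mem_normalize {T : List (Equation α)} (hT : ∀ e ∈ T, e.1.Nodup)
    {e : Equation α} (he : e ∈ normalize T) : ∃ e' ∈ T, e.1.Perm e'.1 := by
  obtain ⟨e', he', rfl⟩ := List.mem_map.1 he
  exact ⟨e', he', perm_filter_support he' (hT e' he')⟩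

theorem eq_of_mem_normalize {T : List (Equation α)} {e e' : Equation α} (he : e ∈ normalize T)
    (he' : e' ∈ normalize T) (h : ∀ v, v ∈ e.1 ↔ v ∈ e'.1) : e.1 = e'.1 := by
  obtain ⟨f, -, rfl⟩ := List.mem_map.1 he
  obtain ⟨g, -, rfl⟩ := List.mem_map.1 he'
  refine List.filter_congr fun v hv => ?_
  simpa [List.mem_filter, hv] using h v

theorem excess_normalize (x : α → ZMod 2) {T : List (Equation α)} (hT : ∀ e ∈ T, e.1.Nodup) :
    excess x (normalize T) = excess x T := by
  rw [excess, normalize, List.map_map, excess]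
  congr 1
  refine List.map_congr_left fun e he => ?_
  rw [Function.comp_apply, val, val, ((perm_filter_support he (hT e he)).map x).sum_eq]

theorem mem_reduce {T : List (Equation α)} {e : Equation α} :
    e ∈ reduce T ↔ netCount T e ≠ 0 := by
  rw [reduce, List.mem_filter, List.mem_dedup, decide_eq_true_eq, and_iff_right_iff_imp]
  exact fun h => List.count_pos_iff.1 (by rw [netCount] at h; omega)

theorem mem_of_mem_reduce {T : List (Equation α)} {e : Equation α} (he : e ∈ reduce T) : e ∈ T :=
  List.mem_dedup.1 (List.mem_of_mem_filter he)

theorem nodup_reduce (T : List (Equation α)) : (reduce T).Nodup :=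
  (List.nodup_dedup T).filter _

theorem flip_notMem_reduce {T : List (Equation α)} {e : Equation α} (he : e ∈ reduce T) :
    e.flip ∉ reduce T := by
  rw [mem_reduce, netCount] at *
  rw [flip_flip]
  omega

theorem excess_eq_sum_reduce (x : α → ZMod 2) (T : List (Equation α)) :
    excess x T = ((reduce T).map fun e => (netCount T e : ℤ) * val x e).sum := by
  set S : Finset (Equation α) := T.toFinset ∪ T.toFinset.image flip with hS
  have hflip : ∀ e ∈ S, e.flip ∈ S := fun e he => by
    rw [hS, Finset.mem_union, Finset.mem_image] at he
    rcases he with he | ⟨e, he, rfl⟩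
    · exact Finset.mem_union_right _ (Finset.mem_image_of_mem _ he)
    · rw [flip_flip]
      exact Finset.mem_union_left _ he
  calc excess x T = ∑ e ∈ T.toFinset, (T.count e : ℤ) * val x e := by
        rw [excess, Finset.sum_list_map_count]
        simp only [nsmul_eq_mul]
        congr!
    _ = ∑ e ∈ S, (T.count e : ℤ) * val x e :=
        Finset.sum_subset Finset.subset_union_left fun e _ he => by
          rw [List.count_eq_zero.2 (by simpa using he), Nat.cast_zero, zero_mul]
    _ = ∑ e ∈ S, (netCount T e : ℤ) * val x e :=
        sum_mul_val_eq_of_sub_flip_eq hflip (fun e _ => by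
          rw [netCount, netCount, flip_flip]
          omega) x
    _ = ∑ e ∈ (reduce T).toFinset, (netCount T e : ℤ) * val x e := by
        refine (Finset.sum_subset (fun e he => ?_) fun e _ he => ?_).symm
        · exact Finset.mem_union_left _
            (List.mem_toFinset.2 (mem_of_mem_reduce (List.mem_toFinset.1 he)))
        · rw [List.mem_toFinset, mem_reduce, not_not] at he
          rw [he, Nat.cast_zero, zero_mul]
    _ = _ := List.sum_toFinset _ (nodup_reduce T)

end Equation

/-! ### Weighted systems -/

/-- The indicator vector of a list. -/
def indVec {α : Type} [DecidableEq α] (l : List α) : α → ZMod 2 := fun v => if v ∈ l then 1 else 0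

section indVec

variable {α : Type} [DecidableEq α] {l : List α}

theorem indVec_apply_ne_zero {v : α} : indVec l v ≠ 0 ↔ v ∈ l := by
  simp [indVec]

theorem mem_iff_of_indVec_eq {l' : List α} (h : indVec l = indVec l') (v : α) :
    v ∈ l ↔ v ∈ l' := by
  rw [← indVec_apply_ne_zero, h, indVec_apply_ne_zero]

theorem indVec_ne_zero (hl : l ≠ []) : indVec l ≠ 0 := fun h =>
  have ⟨v, hv⟩ := List.exists_mem_of_ne_nil l hl
  indVec_apply_ne_zero.2 hv (congrFun h v)

theorem hammingNorm_indVec_le [Fintype α] : hammingNorm (indVec l) ≤ l.length :=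
  le_trans (Finset.card_le_card fun _ hv =>
    List.mem_toFinset.2 (indVec_apply_ne_zero.1 (Finset.mem_filter.1 hv).2)) l.toFinset_card_le

theorem walsh_indVec [Fintype α] (hl : l.Nodup) (x : α → ZMod 2) :
    walsh (indVec l) x = sgn (l.map x).sum := by
  rw [walsh_apply, ← List.sum_toFinset _ hl, dotProduct]
  simp only [indVec, ite_mul, one_mul, zero_mul, ← List.mem_toFinset, Finset.sum_ite_mem,
    Finset.univ_inter]

theorem Equation.val_eq_sgn_mul_walsh [Fintype α] (hl : l.Nodup) (b : ZMod 2) (x : α → ZMod 2) :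
    val x (l, b) = sgn b * walsh (indVec l) x := by
  rw [val, AddChar.map_add_eq_mul, walsh_indVec hl]

end indVec

namespace LinSystem

variable {r : ℕ} (S : LinSystem r)

/-- The coefficients of the excess with respect to the characters. -/
def coeff (t : Fin S.numVars → ZMod 2) : ℤ :=
  (S.equations.map fun e => if indVec e.vars = t then (e.weight : ℤ) * sgn e.rhs else 0).sum

theorem excess_eq_sum_val (z : Fin S.numVars → ZMod 2) :
    S.excess z = (S.equations.map fun e => e.weight * Equation.val z (e.vars, e.rhs)).sum := by
  rw [excess]
  congr 1
  refine List.map_congr_left fun e _ => ?_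
  have hsgn : ∀ a b : ZMod 2, sgn (b + a) = if a = b then 1 else -1 := by decide
  rw [Equation.val, hsgn, mul_ite, mul_one, mul_neg_one]
  rfl

theorem excess_eq_sum_coeff (z : Fin S.numVars → ZMod 2) :
    S.excess z = ∑ t, S.coeff t * walsh t z := by
  simp only [excess_eq_sum_val, coeff, Equation.val_eq_sgn_mul_walsh (LinEquation.nodup _),
    ← mul_assoc]
  induction S.equations with
  | nil => simp
  | cons e l ih =>
    simp only [List.map_cons, List.sum_cons, add_mul, Finset.sum_add_distrib, ← ih, ite_mul,
      zero_mul, Finset.sum_ite_eq, Finset.mem_univ, if_true]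

theorem exists_of_coeff_ne_zero {t : Fin S.numVars → ZMod 2} (ht : S.coeff t ≠ 0) :
    ∃ e ∈ S.equations, indVec e.vars = t := by
  by_contra! h
  refine ht (List.sum_eq_zero fun x hx => ?_)
  obtain ⟨e, he, rfl⟩ := List.mem_map.1 hx
  rw [if_neg (h e he)]

variable {S}

theorem coeff_zero (hne : ∀ e ∈ S.equations, e.vars ≠ []) : S.coeff 0 = 0 := by
  by_contra h
  obtain ⟨e, he, h'⟩ := S.exists_of_coeff_ne_zero h
  exact indVec_ne_zero (hne e he) h'

theorem abs_coeff_indVec (hS : (S.equations.map fun e => indVec e.vars).Nodup)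
    {e : LinEquation r S.numVars} (he : e ∈ S.equations) :
    |S.coeff (indVec e.vars)| = e.weight := by
  classical
  rw [coeff, List.sum_map_eq_nsmul_single e _ fun e' hne he' =>
    if_neg fun h => hne (List.inj_on_of_nodup_map hS he' he h),
    List.count_eq_one_of_mem (List.Nodup.of_map _ hS) he, one_nsmul, if_pos rfl, abs_mul,
    Nat.abs_cast, sgn_eq_ite]
  split_ifs <;> simp

theorem exists_weight_le_excess (hne : ∀ e ∈ S.equations, e.vars ≠ [])
    (hS : (S.equations.map fun e => indVec e.vars).Nodup)
    {e : LinEquation r S.numVars} (he : e ∈ S.equations) : ∃ z, (e.weight : ℤ) ≤ S.excess z := by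
  obtain ⟨z, hz⟩ := exists_abs_le (coeff_zero hne) (indVec_ne_zero (hne e he))
  exact ⟨z, by rwa [excess_eq_sum_coeff, ← abs_coeff_indVec hS he]⟩

theorem exists_le_excess_of_lt_numVars (hne : ∀ e ∈ S.equations, e.vars ≠ [])
    (hS : (S.equations.map fun e => indVec e.vars).Nodup)
    (hocc : ∀ i, ∃ e ∈ S.equations, i ∈ e.vars) {k : ℕ} (hk : 2 * r * k < S.numVars) :
    ∃ z, (k : ℤ) ≤ S.excess z := by
  simp_rw [excess_eq_sum_coeff]
  refine exists_le_of_lt_card (coeff_zero hne) (fun s hs => ?_) (fun i => ?_)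
    (by rwa [Fintype.card_fin])
  · obtain ⟨e, -, rfl⟩ := S.exists_of_coeff_ne_zero hs
    exact hammingNorm_indVec_le.trans e.length_le
  · obtain ⟨e, he, hi⟩ := hocc i
    refine ⟨indVec e.vars, ?_, indVec_apply_ne_zero.2 hi⟩
    rw [← abs_pos, abs_coeff_indVec hS he]
    exact_mod_cast e.weight_pos

end LinSystem

section renumber

variable {α : Type} [DecidableEq α]

/-- The positions in `L` of the elements of `l`. -/
def renumber (L l : List α) (h : ∀ v ∈ l, v ∈ L) : List (Fin L.length) :=
  l.pmap (fun v hv => ⟨L.idxOf v, List.idxOf_lt_length_of_mem hv⟩) h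

variable {L l : List α} {h : ∀ v ∈ l, v ∈ L}

theorem length_renumber : (renumber L l h).length = l.length :=
  List.length_pmap

theorem map_val_renumber : (renumber L l h).map Fin.val = l.map fun v => L.idxOf v := by
  rw [renumber, List.map_pmap]
  exact List.pmap_eq_map _

theorem map_renumber {β : Type} {x : α → β} {z : Fin L.length → β} (hz : ∀ i, z i = x L[i]) :
    (renumber L l h).map z = l.map x := by
  rw [renumber, List.map_pmap, ← List.pmap_eq_map (p := (· ∈ L)) h]
  refine List.pmap_congr_left l fun v _ hv _ => ?_
  rw [hz, Fin.getElem_fin, List.getElem_idxOf]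

theorem map_getElem_renumber : ((renumber L l h).map fun i => L[i]) = l :=
  (map_renumber fun _ => rfl).trans (List.map_id l)

theorem nodup_renumber (hl : l.Nodup) : (renumber L l h).Nodup :=
  List.Nodup.of_map (fun i => L[i]) (by rwa [map_getElem_renumber])

theorem mem_renumber (hL : L.Nodup) {i : Fin L.length} : i ∈ renumber L l h ↔ L[i] ∈ l := by
  rw [← List.mem_map_of_injective (f := fun i : Fin L.length => L[i])
    hL.injective_get, map_getElem_renumber]

end renumber

namespace Equation

variable {α : Type}

/-- Equations without constants, with at most `r` variables each and with left-hand sides that are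
equal as lists if they are equal as sets. -/
structure IsNormalized (r : ℕ) (T : List (Equation α)) : Prop where
  ne_nil : ∀ e ∈ T, e.1 ≠ []
  nodup : ∀ e ∈ T, e.1.Nodup
  length_le : ∀ e ∈ T, e.1.length ≤ r
  eq_of_mem_iff : ∀ e ∈ T, ∀ e' ∈ T, (∀ v, v ∈ e.1 ↔ v ∈ e'.1) → e.1 = e'.1

variable [DecidableEq α] {T : List (Equation α)} {r : ℕ}

theorem mem_support_of_mem {e : Equation α} (he : e ∈ T) : ∀ v ∈ e.1, v ∈ support T :=
  fun _ hv => mem_support.2 ⟨e, he, hv⟩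

/-- A cheap sufficient condition for an excess of at least `k`: some weight is at least `k`, or more
than `2 * r * k` variables survive the cancellation. -/
def IsLarge (r k : ℕ) (T : List (Equation α)) : Prop :=
  (∃ e ∈ reduce T, k ≤ netCount T e) ∨ 2 * r * k < (support (reduce T)).length

instance (r k : ℕ) (T : List (Equation α)) : Decidable (IsLarge r k T) :=
  inferInstanceAs (Decidable (_ ∨ _))

namespace IsNormalized

theorem fst_injOn_reduce (hT : IsNormalized r T) {e e' : Equation α} (he : e ∈ reduce T)
    (he' : e' ∈ reduce T) (h : ∀ v, v ∈ e.1 ↔ v ∈ e'.1) : e = e' := by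
  have hfst := hT.eq_of_mem_iff e (mem_of_mem_reduce he) e' (mem_of_mem_reduce he') h
  by_cases hsnd : e.2 = e'.2
  · exact Prod.ext hfst hsnd
  · have hadd : ∀ a b : ZMod 2, a ≠ b → b = a + 1 := by decide
    refine absurd he' ?_
    rw [show e' = e.flip from Prod.ext hfst.symm (hadd _ _ hsnd)]
    exact flip_notMem_reduce he

/-- The weighted system of the equations that survive the cancellation, in the variables that
occur in them. -/
def system (hT : IsNormalized r T) : LinSystem r where
  numVars := (support (reduce T)).length
  equations := (reduce T).attach.map fun e =>
    { vars := renumber (support (reduce T)) e.1.1 (mem_support_of_mem e.2)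
      nodup := nodup_renumber (hT.nodup _ (mem_of_mem_reduce e.2))
      length_le := length_renumber.trans_le (hT.length_le _ (mem_of_mem_reduce e.2))
      rhs := e.1.2
      weight := netCount T e.1
      weight_pos := Nat.pos_of_ne_zero (mem_reduce.1 e.2) }

variable (hT : IsNormalized r T)

theorem vars_ne_nil_of_mem_system : ∀ e ∈ hT.system.equations, e.vars ≠ [] := by
  intro e he
  obtain ⟨e, -, rfl⟩ := List.mem_map.1 he
  exact fun h => hT.ne_nil _ (mem_of_mem_reduce e.2) (List.pmap_eq_nil_iff.1 h)

theorem nodup_indVec_system : (hT.system.equations.map fun e => indVec e.vars).Nodup := by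
  rw [system, List.map_map]
  refine List.Nodup.map_on (fun e _ e' _ h => Subtype.ext ?_)
    (List.nodup_attach.2 (nodup_reduce T))
  have hiff : ∀ e ∈ reduce T, ∀ v, v ∈ e.1 ↔
      ∃ i : Fin (support (reduce T)).length, (support (reduce T))[i] = v ∧
        (support (reduce T))[i] ∈ e.1 := fun e he v =>
    ⟨fun hv => ⟨⟨_, List.idxOf_lt_length_of_mem (mem_support_of_mem he v hv)⟩, by simpa using hv⟩,
      fun ⟨_, hi, hv⟩ => hi ▸ hv⟩
  refine hT.fst_injOn_reduce e.2 e'.2 fun v => ?_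
  rw [hiff _ e.2, hiff _ e'.2]
  simp only [← mem_renumber (nodup_support _) (h := mem_support_of_mem e.2),
    ← mem_renumber (nodup_support _) (h := mem_support_of_mem e'.2)]
  exact exists_congr fun i => and_congr_right fun _ => mem_iff_of_indVec_eq h i

theorem exists_mem_vars_system : ∀ i, ∃ e ∈ hT.system.equations, i ∈ e.vars := by
  intro i
  obtain ⟨e, he, hv⟩ := mem_support.1 (List.getElem_mem (l := support (reduce T)) i.2)
  exact ⟨_, List.mem_map_of_mem (List.mem_attach _ ⟨e, he⟩),
    (mem_renumber (nodup_support _)).2 hv⟩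

theorem excess_system {x : α → ZMod 2} {z : Fin hT.system.numVars → ZMod 2}
    (hz : ∀ i, z i = x ((support (reduce T))[i])) : hT.system.excess z = excess x T := by
  rw [LinSystem.excess_eq_sum_val, excess_eq_sum_reduce, ← List.attach_map_val (l := reduce T)]
  refine congrArg List.sum ((List.map_map ..).trans (List.map_congr_left fun e _ => ?_))
  exact congrArg (fun l : List (ZMod 2) => (netCount T e.1 : ℤ) * sgn (e.1.2 + l.sum))
    (map_renumber hz)

theorem exists_le_excess_system_iff {k : ℤ} :
    (∃ z, k ≤ hT.system.excess z) ↔ ∃ x, k ≤ excess x T := by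
  constructor
  · rintro ⟨z, hz⟩
    refine ⟨Function.extend (support (reduce T)).get z 0, ?_⟩
    rwa [← hT.excess_system fun i => (((nodup_support _).injective_get).extend_apply z 0 i).symm]
  · rintro ⟨x, hx⟩
    exact ⟨fun i => x ((support (reduce T))[i]), by rwa [hT.excess_system fun _ => rfl]⟩

include hT in
theorem exists_le_excess_of_isLarge {k : ℕ} (hk : IsLarge r k T) :
    ∃ x, (k : ℤ) ≤ excess x T := by
  rw [← hT.exists_le_excess_system_iff]
  rcases hk with ⟨e, he, hk⟩ | hk
  · obtain ⟨z, hz⟩ := LinSystem.exists_weight_le_excess hT.vars_ne_nil_of_mem_system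
      hT.nodup_indVec_system (List.mem_map_of_mem (List.mem_attach _ ⟨e, he⟩))
    exact ⟨z, le_trans (Int.ofNat_le.2 hk) hz⟩
  · exact LinSystem.exists_le_excess_of_lt_numVars hT.vars_ne_nil_of_mem_system
      hT.nodup_indVec_system hT.exists_mem_vars_system hk

end IsNormalized

end Equation

/-! ### The equations of an instance of Max `r`-CSP -/

namespace Equation

variable {α β : Type}

theorem isNormalized_normalize [DecidableEq α] {r : ℕ} {T : List (Equation α)}
    (hne : ∀ e ∈ T, e.1 ≠ []) (hnd : ∀ e ∈ T, e.1.Nodup) (hr : ∀ e ∈ T, e.1.length ≤ r) :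
    IsNormalized r (normalize T) where
  ne_nil e he h := by
    obtain ⟨e', he', hp⟩ := exists_perm_of_mem_normalize hnd he
    exact hne e' he' (h ▸ hp).nil_eq.symm
  nodup e he := by
    obtain ⟨e', he', hp⟩ := exists_perm_of_mem_normalize hnd he
    exact hp.nodup_iff.2 (hnd e' he')
  length_le e he := by
    obtain ⟨e', he', hp⟩ := exists_perm_of_mem_normalize hnd he
    exact hp.length_eq.trans_le (hr e' he')
  eq_of_mem_iff _ he _ he' := eq_of_mem_normalize he he'

/-- The equations with at least one variable. -/
def nonconstant (T : List (Equation α)) : List (Equation α) := T.filter fun e => !e.1.isEmpty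

theorem mem_nonconstant {T : List (Equation α)} {e : Equation α} :
    e ∈ nonconstant T ↔ e ∈ T ∧ e.1 ≠ [] := by
  simp [nonconstant]

theorem sum_val_eq_zero [Fintype α] [DecidableEq α] {e : Equation α} (he : e.1.Nodup)
    (hne : e.1 ≠ []) : ∑ x, val x e = 0 := by
  simp_rw [fun x => val_eq_sgn_mul_walsh he e.2 x]
  rw [← Finset.mul_sum, sum_walsh, if_neg (indVec_ne_zero hne), mul_zero]

-- Characters other than the constant one average to `0`.
theorem two_pow_mul_excess_nonconstant [Fintype α] [DecidableEq α] {T : List (Equation α)}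
    (hT : ∀ e ∈ T, e.1.Nodup) (x : α → ZMod 2) :
    2 ^ Fintype.card α * excess x (nonconstant T) =
      2 ^ Fintype.card α * excess x T - ∑ y, excess y T := by
  induction T with
  | nil => simp [nonconstant, excess]
  | cons e T ih =>
    have ih := ih fun e' he' => hT e' (List.mem_cons_of_mem _ he')
    have hcons : ∀ (y : α → ZMod 2) (T' : List (Equation α)),
        excess y (e :: T') = val y e + excess y T' := fun _ _ => List.sum_cons
    rw [nonconstant] at ih ⊢
    simp only [hcons, Finset.sum_add_distrib, mul_add]
    by_cases he : e.1 = []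
    · have hval : ∀ y, val y e = sgn e.2 := fun y => by rw [val, he, List.map_nil, List.sum_nil,
        add_zero]
      rw [List.filter_cons_of_neg (by simp [he]), ih]
      simp only [hval, Finset.sum_const, Finset.card_univ, Fintype.card_fun, ZMod.card]
      ring
    · rw [List.filter_cons_of_pos (by simpa using he), hcons, mul_add, ih,
        sum_val_eq_zero (hT e List.mem_cons_self) he]
      ring

/-- The equation in renamed variables. -/
def map (f : α → β) (e : Equation α) : Equation β := (e.1.map f, e.2)

theorem val_map (f : α → β) (e : Equation α) (x : β → ZMod 2) :
    val x (map f e) = val (x ∘ f) e := by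
  rw [val, val, map, List.map_map]

theorem excess_map (f : α → β) (T : List (Equation α)) (x : β → ZMod 2) :
    excess x (T.map (map f)) = excess (x ∘ f) T := by
  rw [excess, excess, List.map_map]
  exact congrArg List.sum (List.map_congr_left fun e _ => val_map f e x)

theorem expand_map (f : α → β) (d : ℕ) (t : BTree) (vs : List α) :
    expand d t (vs.map f) = (expand d t vs).map (map f) := by
  induction d generalizing t vs with
  | zero => by_cases ht : t.isCons <;> simp [expand, ht, map]
  | succ d ih =>
    cases vs with
    | nil => rw [List.map_nil, expand, expand, List.map_append, ← ih, List.map_nil]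
    | cons v vs =>
      simp only [List.map_cons, expand, ih, List.map_append, List.map_map]
      rfl

end Equation

namespace CSP

open Equation

variable {r : ℕ} (I : CSP r)

/-- The Fourier expansion of `2 ^ r` times the number of satisfied functions. -/
def expansion : List (Equation (Fin I.numVars)) :=
  I.constraints.flatMap fun c => expand r (encTable c.vars.length c.table) c.vars

/-- Equations whose excess is `2 ^ r` times the number of satisfied functions minus its average. -/
def equations : List (Equation ℕ) :=
  normalize ((nonconstant I.expansion).map (Equation.map Fin.val))

theorem exists_sublist_of_mem_expansion {e : Equation (Fin I.numVars)} (he : e ∈ I.expansion) :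
    ∃ c ∈ I.constraints, e.1.Sublist c.vars := by
  obtain ⟨c, hc, he⟩ := List.mem_flatMap.1 he
  exact ⟨c, hc, sublist_of_mem_expand he⟩

theorem nodup_of_mem_expansion {e : Equation (Fin I.numVars)} (he : e ∈ I.expansion) :
    e.1.Nodup := by
  obtain ⟨c, -, hs⟩ := I.exists_sublist_of_mem_expansion he
  exact hs.nodup c.nodup

theorem excess_expansion (z : Fin I.numVars → ZMod 2) :
    excess z I.expansion = 2 ^ r * I.numSat fun i => decide (z i = 1) := by
  rw [expansion, numSat]
  induction I.constraints with
  | nil => simp [excess]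
  | cons c l ih =>
    rw [List.flatMap_cons, excess_append, ih, excess_expand z c.table c.length_le,
      List.countP_cons, Constraint.eval]
    push_cast
    split_ifs <;> ring

theorem average_add_le_numSat_iff (z : Fin I.numVars → ZMod 2) (k : ℕ) :
    I.average + (k : ℚ) / 2 ^ r ≤ I.numSat (fun i => decide (z i = 1)) ↔
      (k : ℤ) ≤ excess z (nonconstant I.expansion) := by
  have hsum : ∑ x : Fin I.numVars → Bool, (I.numSat x : ℤ) =
      ∑ z : Fin I.numVars → ZMod 2, (I.numSat fun i => decide (z i = 1) : ℤ) :=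
    (Fintype.sum_equiv (Equiv.piCongrRight fun _ => finTwoEquiv) _ _ fun _ => rfl).symm
  have hexcess : (2 : ℚ) ^ I.numVars * excess z (nonconstant I.expansion) =
      2 ^ r * (2 ^ I.numVars * I.numSat (fun i => decide (z i = 1)) -
        ∑ x : Fin I.numVars → Bool, (I.numSat x : ℚ)) := by
    have h := two_pow_mul_excess_nonconstant (fun _ => I.nodup_of_mem_expansion) z
    simp only [excess_expansion, ← Finset.mul_sum, ← hsum, Fintype.card_fin] at h
    rw [mul_sub, mul_left_comm]
    exact_mod_cast h
  have havg : (2 : ℚ) ^ I.numVars * I.average = ∑ x : Fin I.numVars → Bool, (I.numSat x : ℚ) :=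
    mul_div_cancel₀ _ (by positivity)
  rw [← havg, ← mul_sub, mul_left_comm] at hexcess
  rw [← Int.cast_le (R := ℚ), mul_left_cancel₀ (by positivity) hexcess, Int.cast_natCast,
    ← le_sub_iff_add_le', div_le_iff₀' (by positivity)]

theorem nodup_of_mem_map_nonconstant {e : Equation ℕ}
    (he : e ∈ (nonconstant I.expansion).map (Equation.map Fin.val)) : e.1.Nodup := by
  obtain ⟨e', he', rfl⟩ := List.mem_map.1 he
  exact (I.nodup_of_mem_expansion (mem_nonconstant.1 he').1).map Fin.val_injective

theorem yes_iff_exists_le_excess (k : ℕ) :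
    (MaxCSP r).Yes I k ↔ ∃ x, (k : ℤ) ≤ excess x I.equations := by
  have hexcess : ∀ x, excess x I.equations = excess (x ∘ Fin.val) (nonconstant I.expansion) :=
    fun x => by
      rw [equations, excess_normalize x fun _ => I.nodup_of_mem_map_nonconstant, excess_map]
  have hextend : Function.Surjective fun (x : ℕ → ZMod 2) => x ∘ (Fin.val : Fin I.numVars → ℕ) :=
    fun z => ⟨_, Function.extend_comp Fin.val_injective z 0⟩
  simp_rw [hexcess, ← average_add_le_numSat_iff]
  rw [← hextend.exists
    (p := fun z => I.average + (k : ℚ) / 2 ^ r ≤ I.numSat fun i => decide (z i = 1))]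
  exact (Equiv.piCongrRight fun _ => finTwoEquiv).surjective.exists

theorem isNormalized_equations : IsNormalized r I.equations := by
  refine isNormalized_normalize (fun e he => ?_) (fun _ => I.nodup_of_mem_map_nonconstant)
    fun e he => ?_ <;> obtain ⟨e', he', rfl⟩ := List.mem_map.1 he
  · exact fun h => (mem_nonconstant.1 he').2 (List.map_eq_nil_iff.1 h)
  · obtain ⟨c, -, hs⟩ := I.exists_sublist_of_mem_expansion (mem_nonconstant.1 he').1
    exact List.length_map Fin.val ▸ hs.length_le.trans c.length_le

end CSP

/-! ### The bikernelization -/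

section

instance : TreeEnc (ZMod 2) := ⟨fun a => enc a.val⟩

instance : PolyEq (ZMod 2) where
  polyTime_decide_eq :=
    (PolyEq.polyTime_decide_eq (α := ℕ)).of_enc_eq (fun p => (p.1.val, p.2.val)) (fun _ => rfl)
      fun p => by simp only [(ZMod.val_injective 2).eq_iff]

variable {α β : Type} [TreeEnc α] [TreeEnc β]

@[fun_prop]
theorem PolyTime.add {f g : α → ZMod 2} (hf : PolyTime f) (hg : PolyTime g) :
    PolyTime fun a => f a + g a :=
  (PolyTime.ite (c := fun a => f a = g a) (hf.decide_eq hg) (const 0) (const 1)).of_eq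
    fun a => by generalize f a = b, g a = c; revert b c; decide

@[fun_prop]
theorem PolyTime.sum {l : α → List (ZMod 2)} (hl : PolyTime l) : PolyTime fun a => (l a).sum :=
  (hl.foldl (f := fun _ s x => s + x) (G := fun _ => 4) (const 0) (by fun_prop) (.const _ 4)
    fun _ s x => by
      have hsize := tsize_nat_le (s + x).val
      have hval := ZMod.val_lt (s + x)
      have hs := tsize_pos s
      have htsize : tsize (s + x) = tsize (s + x).val := rfl
      omega).of_eq fun a => List.sum_eq_foldl.symm

namespace Equation

@[fun_prop]
theorem polyTime_flip : PolyTime (flip : Equation β → Equation β) := by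
  unfold flip
  fun_prop

@[fun_prop]
theorem polyTime_expand (d : ℕ) {t : α → BTree} {l : α → List β} (ht : PolyTime t)
    (hl : PolyTime l) : PolyTime fun a => expand d (t a) (l a) := by
  induction d generalizing t l with
  | zero => exact (PolyTime.ite (c := fun a => (t a).isCons = true) (f := fun _ => [([], 0)])
      (g := fun _ => []) (by fun_prop) (by fun_prop) (by fun_prop)).of_eq fun a => by rw [expand]
  | succ d ih =>
    have hcons : PolyTime fun a =>
        (expand d (t a).left (l a).tail ++ expand d (t a).right (l a).tail) ++
          ((expand d (t a).left (l a).tail).map (fun e => ((l a).take 1 ++ e.1, e.2)) ++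
            (expand d (t a).right (l a).tail).map fun e => ((l a).take 1 ++ e.1, e.2 + 1)) := by
      fun_prop
    have hnil : PolyTime fun a => expand d (t a) [] ++ expand d (t a) ([] : List β) := by
      fun_prop
    refine (PolyTime.ite (c := fun a => (l a).isEmpty = true) (by fun_prop) hnil hcons).of_eq
      fun a => ?_
    cases l a <;> simp [expand]

@[fun_prop]
theorem polyTime_nonconstant :
    PolyTime (nonconstant : List (Equation β) → List (Equation β)) := by
  unfold nonconstant
  fun_prop

variable [DecidableEq β] [PolyEq β]

@[fun_prop]
theorem polyTime_support : PolyTime (support : List (Equation β) → List β) := by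
  unfold support
  fun_prop

@[fun_prop]
theorem polyTime_normalize : PolyTime (normalize : List (Equation β) → List (Equation β)) := by
  unfold normalize
  fun_prop

@[fun_prop]
theorem polyTime_netCount {T : α → List (Equation β)} {e : α → Equation β} (hT : PolyTime T)
    (he : PolyTime e) : PolyTime fun a => netCount (T a) (e a) := by
  simp only [netCount_eq_length_drop]
  fun_prop

@[fun_prop]
theorem polyTime_decide_le_netCount {k : α → ℕ} {T : α → List (Equation β)} {e : α → Equation β}
    (hk : PolyTime k) (hT : PolyTime T) (he : PolyTime e) :
    PolyTime fun a => decide (k a ≤ netCount (T a) (e a)) := by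
  simp only [netCount_eq_length_drop]
  fun_prop

@[fun_prop]
theorem polyTime_reduce : PolyTime (reduce : List (Equation β) → List (Equation β)) := by
  unfold reduce
  fun_prop

@[fun_prop]
theorem polyTime_decide_isLarge (r : ℕ) {k : α → ℕ} {T : α → List (Equation β)} (hk : PolyTime k)
    (hT : PolyTime T) : PolyTime fun a => decide (IsLarge r (k a) (T a)) := by
  refine PolyTime.of_eq (f := fun a =>
    (reduce (T a)).any (fun e => decide (k a ≤ netCount (T a) e)) ||
      decide (2 * r * k a < (support (reduce (T a))).length)) (by fun_prop) fun a => ?_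
  rw [Bool.eq_iff_iff]
  simp only [Bool.or_eq_true, List.any_eq_true, decide_eq_true_iff]
  rfl

end Equation

end

theorem enc_map {α β : Type} [TreeEnc α] [TreeEnc β] {f : α → β} (hf : ∀ a, enc (f a) = enc a)
    (l : List α) : enc (l.map f) = enc l := by
  induction l with
  | nil => rfl
  | cons a l ih => exact congrArg₂ BTree.cons (hf a) ih

section

variable {α : Type} [TreeEnc α] {r n : ℕ}

instance : TreeEnc (Fin n) := ⟨fun i => enc i.val⟩

instance : TreeEnc (Constraint r n) := ⟨Constraint.enc⟩

instance : TreeEnc (CSP r) := ⟨CSP.enc⟩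

instance : TreeEnc (LinEquation r n) := ⟨LinEquation.enc⟩

instance : TreeEnc (LinSystem r) := ⟨LinSystem.enc⟩

theorem enc_map_val (l : List (Fin n)) : TreeEnc.enc (l.map Fin.val) = TreeEnc.enc l :=
  enc_map (f := Fin.val) (fun _ => rfl) l

/-- The variable lists and truth tables of the constraints, as they are encoded. -/
def CSP.tables (I : CSP r) : List (List ℕ × BTree) :=
  I.constraints.map fun c => (c.vars.map Fin.val, encTable c.vars.length c.table)

@[fun_prop]
theorem CSP.polyTime_tables : PolyTime (CSP.tables : CSP r → _) := by
  refine PolyTime.snd.of_enc_eq (fun I : CSP r => (I.numVars, I.tables)) (fun I => ?_)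
    fun _ => rfl
  have htables : TreeEnc.enc I.tables = TreeEnc.enc I.constraints :=
    enc_map (fun c => congrArg (BTree.cons · (encTable _ c.table)) (enc_map_val c.vars))
      I.constraints
  exact (congrArg (BTree.cons _) htables).symm

theorem CSP.equations_eq_tables (I : CSP r) : I.equations =
    Equation.normalize (Equation.nonconstant
      (I.tables.flatMap fun c => Equation.expand r c.2 c.1)) := by
  have h : I.tables.flatMap (fun c => Equation.expand r c.2 c.1) =
      I.expansion.map (Equation.map Fin.val) := by
    simp only [CSP.tables, List.flatMap_map, CSP.expansion, List.map_flatMap, Equation.expand_map]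
  rw [h, CSP.equations, Equation.nonconstant, Equation.nonconstant, List.filter_map]
  simp [Function.comp_def, Equation.map]

@[fun_prop]
theorem CSP.polyTime_equations : PolyTime (CSP.equations : CSP r → _) :=
  PolyTime.of_eq (by fun_prop) fun I => I.equations_eq_tables.symm

open Equation in
theorem Equation.IsNormalized.enc_system {T : List (Equation ℕ)} (hT : IsNormalized r T) :
    enc hT.system = enc ((support (reduce T)).length, (reduce T).map fun e =>
      (e.1.map fun v => (support (reduce T)).idxOf v, e.2, netCount T e)) := by
  have hmap : hT.system.equations.map (fun e => (e.vars.map Fin.val, e.rhs, e.weight)) =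
      (reduce T).map fun e =>
        (e.1.map fun v => (support (reduce T)).idxOf v, e.2, netCount T e) := by
    rw [system, List.map_map, ← List.attach_map_val (l := reduce T)]
    simp only [Function.comp_def, map_val_renumber]
  rw [← hmap]
  refine congrArg (BTree.cons _) (enc_map (fun e => ?_) hT.system.equations).symm
  exact congrArg (BTree.cons · _) (enc_map_val e.vars)

open Equation in
theorem Equation.IsNormalized.polyTime_system {T : α → List (Equation ℕ)} (hT : PolyTime T)
    (hr : ∀ a, IsNormalized r (T a)) : PolyTime fun a => (hr a).system :=
  PolyTime.of_enc_eq (f := fun a => ((support (reduce (T a))).length, (reduce (T a)).map fun e =>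
    (e.1.map fun v => (support (reduce (T a))).idxOf v, e.2, netCount (T a) e))) (by fun_prop) id
    (fun _ => rfl) fun a => (hr a).enc_system

/-- The bikernelization from Max `r`-CSP to Max `r`-Lin AA. -/
def kernel (I : CSP r) (k : ℕ) : LinSystem r × ℕ :=
  if Equation.IsLarge r k I.equations then (⟨0, []⟩, 0) else (I.isNormalized_equations.system, k)

theorem polyTime_kernel : PolyTime fun p : CSP r × ℕ => kernel p.1 p.2 := by
  have hsystem := Equation.IsNormalized.polyTime_system (by fun_prop)
    fun p : CSP r × ℕ => p.1.isNormalized_equations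
  unfold kernel
  fun_prop

theorem yes_kernel_iff (I : CSP r) (k : ℕ) :
    (MaxLinAA r).Yes (kernel I k).1 (kernel I k).2 ↔ (MaxCSP r).Yes I k := by
  rw [I.yes_iff_exists_le_excess, kernel]
  split_ifs with h
  · exact iff_of_true ⟨0, le_rfl⟩ (I.isNormalized_equations.exists_le_excess_of_isLarge h)
  · exact I.isNormalized_equations.exists_le_excess_system_iff

theorem numVars_kernel_le (I : CSP r) (k : ℕ) : (kernel I k).1.numVars ≤ 2 * r * k := by
  rw [kernel]
  split_ifs with h
  · exact Nat.zero_le _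
  · exact not_lt.1 (not_or.1 h).2

theorem LinEquation.tsize_le (e : LinEquation r n) :
    tsize e ≤ r * (4 * n + 2) + 4 * e.weight + 10 := by
  have hvars : tsize e.vars ≤ e.vars.length * (4 * n + 2) + 1 :=
    tsize_list_le fun i _ => (tsize_nat_le i).trans (by omega)
  have hlength := Nat.mul_le_mul_right (4 * n + 2) e.length_le
  have hrhs := tsize_nat_le e.rhs.val
  have hval := ZMod.val_lt e.rhs
  have hweight := tsize_nat_le e.weight
  have htsize : tsize e = tsize e.vars + (tsize e.rhs.val + tsize e.weight + 1) + 1 := rfl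
  omega

theorem LinSystem.tsize_le {S : LinSystem r} {k : ℕ} (hn : S.numVars ≤ n)
    (hS : (S.equations.map fun e => indVec e.vars).Nodup)
    (hk : ∀ e ∈ S.equations, e.weight ≤ k) :
    tsize S ≤ 2 ^ n * (r * (4 * n + 2) + 4 * k + 10 + 1) + 4 * n + 3 := by
  have hequation : ∀ e ∈ S.equations, tsize e ≤ r * (4 * n + 2) + 4 * k + 10 := fun e he =>
    e.tsize_le.trans (by gcongr; exact hk e he)
  have hlength : S.equations.length ≤ 2 ^ n := by
    have hcard := hS.length_le_card
    simp only [List.length_map, Fintype.card_fun, ZMod.card, Fintype.card_fin] at hcard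
    exact hcard.trans (Nat.pow_le_pow_right two_pos hn)
  have hequations := (tsize_list_le hequation).trans
    (Nat.succ_le_succ (Nat.mul_le_mul_right _ hlength))
  have hnumVars := tsize_nat_le S.numVars
  have htsize : tsize S = tsize S.numVars + tsize S.equations + 1 := rfl
  omega

theorem tsize_kernel_le (I : CSP r) (k : ℕ) : tsize (kernel I k).1 ≤
    2 ^ (2 * r * k) * (r * (4 * (2 * r * k) + 2) + 4 * k + 10 + 1) + 4 * (2 * r * k) + 3 := by
  refine LinSystem.tsize_le (numVars_kernel_le I k) ?_ ?_ <;>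
    by_cases h : Equation.IsLarge r k I.equations
  · rw [kernel, if_pos h]
    exact List.nodup_nil
  · rw [kernel, if_neg h]
    exact I.isNormalized_equations.nodup_indVec_system
  · rw [kernel, if_pos h]
    exact List.forall_mem_nil _
  · rw [kernel, if_neg h]
    intro e he
    obtain ⟨e, -, rfl⟩ := List.mem_map.1 he
    exact le_of_not_ge fun hk => h (.inl ⟨e.1, e.2, hk⟩)

theorem isBikernelization_kernel : IsBikernelization (MaxCSP r) (MaxLinAA r) kernel := by
  obtain ⟨p, t, ⟨P, hP⟩, hp⟩ := polyTime_kernel (r := r)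
  have hparam : ∀ (I : CSP r) k, (kernel I k).2 ≤ k := fun I k => by
    unfold kernel
    split_ifs <;> simp
  exact ⟨⟨p, P, fun I k => ⟨t (I, k), hP (I, k), hp (I, k)⟩⟩,
    fun I k => (yes_kernel_iff I k).symm,
    ⟨_, hparam⟩,
    ⟨_, tsize_kernel_le⟩⟩

end

/-! ### The search -/

theorem tsize_sublists_le {τ : Type} [TreeEnc τ] (l : List τ) :
    tsize l.sublists ≤ 2 ^ l.length * (tsize l + 1) + 1 := by
  rw [← List.length_sublists]
  exact tsize_list_le fun _ hs => tsize_le_of_sublist (List.mem_sublists.1 hs)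

theorem PolyTimeIn.sublists {α τ : Type} [TreeEnc α] [TreeEnc τ] {B : α → ℕ} {l : α → List τ}
    (hl : PolyTimeIn B l) (h : IsPolyBounded B fun a => 2 ^ (l a).length) :
    PolyTimeIn B fun a => (l a).sublists := by
  have hfoldl : ∀ l : List τ, l.foldl (fun s v => s ++ s.map (· ++ [v])) [[]] = l.sublists :=
    fun l => by
      induction l using List.reverseRecOn with
      | nil => rfl
      | append_singleton l v ih =>
        rw [List.foldl_append, ih, List.foldl_cons, List.foldl_nil, List.sublists_concat]
  have hS := (h.mul (hl.tsize_output.add (.const B 1))).add (.const B 1)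
  have hinit : PolyTimeIn B fun _ => ([[]] : List (List τ)) :=
    (PolyTime.const _).polyTimeIn hl.tsize_input
  have hsublists := hl.foldl (f := fun _ s v => s ++ s.map (· ++ [v])) hinit (by fun_prop) hS
    fun a l' hl' => by
      rw [hfoldl]
      refine (tsize_sublists_le l').trans (Nat.succ_le_succ (Nat.mul_le_mul ?_ ?_))
      · exact Nat.pow_le_pow_right two_pos hl'.length_le
      · exact Nat.succ_le_succ (tsize_le_of_sublist hl'.sublist)
  simpa only [hfoldl] using hsublists

namespace Equation

variable {α β : Type}

theorem le_excess_iff (k : ℕ) (x : α → ZMod 2) (T : List (Equation α)) :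
    (k : ℤ) ≤ excess x T ↔ k + (T.filter fun e => !decide (e.2 + (e.1.map x).sum = 0)).length ≤
      (T.filter fun e => decide (e.2 + (e.1.map x).sum = 0)).length := by
  have h : excess x T = (T.filter fun e => decide (e.2 + (e.1.map x).sum = 0)).length -
      (T.filter fun e => !decide (e.2 + (e.1.map x).sum = 0)).length := by
    rw [excess]
    induction T with
    | nil => rfl
    | cons e T ih =>
      rw [List.map_cons, List.sum_cons, ih, val, sgn_eq_ite]
      by_cases he : e.2 + (e.1.map x).sum = 0 <;> simp [he] <;> ring
  omega

variable [DecidableEq α]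

theorem excess_congr {x y : α → ZMod 2} {T : List (Equation α)}
    (h : ∀ v ∈ support (reduce T), x v = y v) : excess x T = excess y T := by
  rw [excess_eq_sum_reduce, excess_eq_sum_reduce]
  refine congrArg List.sum (List.map_congr_left fun e he => ?_)
  rw [val_congr fun v hv => h v (mem_support_of_mem he v hv)]

theorem exists_le_excess_iff {k : ℤ} {T : List (Equation α)} : (∃ x, k ≤ excess x T) ↔
    ∃ A ∈ (support (reduce T)).sublists, k ≤ excess (indVec A) T := by
  refine ⟨fun ⟨x, hx⟩ => ⟨(support (reduce T)).filter (x · = 1),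
    List.mem_sublists.2 List.filter_sublist, hx.trans_eq (excess_congr fun v hv => ?_)⟩,
    fun ⟨A, _, hA⟩ => ⟨_, hA⟩⟩
  have hbit : ∀ b : ZMod 2, b = if b = 1 then 1 else 0 := by decide
  simpa [indVec, hv] using hbit (x v)

@[fun_prop]
theorem polyTime_decide_le_excess [TreeEnc α] [PolyEq α] [TreeEnc β] {k : β → ℕ}
    {A : β → List α} {T : β → List (Equation α)} (hk : PolyTime k) (hA : PolyTime A)
    (hT : PolyTime T) : PolyTime fun b => decide ((k b : ℤ) ≤ excess (indVec (A b)) (T b)) := by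
  simp only [le_excess_iff]
  unfold indVec
  fun_prop

end Equation

section

variable {r : ℕ}

namespace CSP

/-- The assignments that decide an instance of Max `r`-CSP, as the lists of the variables of value
`1`: only the zero assignment if the answer is known to be yes, otherwise all the assignments to
the variables of the kernel. -/
def candidates (I : CSP r) (k : ℕ) : List (List ℕ) :=
  (if Equation.IsLarge r k I.equations then []
    else Equation.support (Equation.reduce I.equations)).sublists

/-- The answer to an instance of Max `r`-CSP. -/
def answer (I : CSP r) (k : ℕ) : Bool :=
  decide (Equation.IsLarge r k I.equations) ||
    (I.candidates k).any fun A => decide ((k : ℤ) ≤ Equation.excess (indVec A) I.equations)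

theorem answer_eq_true_iff (I : CSP r) (k : ℕ) : I.answer k = true ↔ (MaxCSP r).Yes I k := by
  rw [I.yes_iff_exists_le_excess, answer, Bool.or_eq_true, decide_eq_true_iff]
  by_cases h : Equation.IsLarge r k I.equations
  · exact iff_of_true (.inl h) (I.isNormalized_equations.exists_le_excess_of_isLarge h)
  · simp only [h, false_or, List.any_eq_true, decide_eq_true_iff, candidates, if_false,
      Equation.exists_le_excess_iff]

theorem polyTimeIn_candidates : PolyTimeIn (fun p : CSP r × ℕ => tsize p + 2 ^ (2 * r * p.2))
    fun p => p.1.candidates p.2 := by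
  have hB := IsPolyBounded.refl fun p : CSP r × ℕ => tsize p + 2 ^ (2 * r * p.2)
  refine PolyTimeIn.sublists (PolyTime.polyTimeIn (by fun_prop) (hB.mono fun p => ?_))
    (hB.mono fun p => ?_)
  · exact Nat.le_add_right _ _
  · refine le_add_left (Nat.pow_le_pow_right two_pos ?_)
    split_ifs with h
    · exact Nat.zero_le _
    · exact not_lt.1 (not_or.1 h).2

theorem polyTimeIn_answer : PolyTimeIn (fun p : CSP r × ℕ => tsize p + 2 ^ (2 * r * p.2))
    fun p => p.1.answer p.2 := by
  have hinput := PolyTime.id.polyTimeIn (polyTimeIn_candidates (r := r)).tsize_input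
  have hsearch : PolyTime fun q : (CSP r × ℕ) × List (List ℕ) =>
      decide (Equation.IsLarge r q.1.2 q.1.1.equations) ||
        q.2.any fun A => decide ((q.1.2 : ℤ) ≤ Equation.excess (indVec A) q.1.1.equations) := by
    fun_prop
  have hanswer := hsearch.comp_polyTimeIn (hinput.pair polyTimeIn_candidates)
  exact hanswer

end CSP

theorem eval_add_le (P : Polynomial ℕ) (a b : ℕ) :
    P.eval (a + b) ≤ P.eval (2 * a) + P.eval (2 * b) := by
  rcases le_total a b with h | h
  · exact le_add_left (eval_le_eval P (by omega))
  · exact le_add_right (eval_le_eval P (by omega))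

theorem eval_le_mul_pow (P : Polynomial ℕ) {n : ℕ} (hn : 0 < n) :
    P.eval n ≤ P.eval 1 * n ^ P.natDegree := by
  rw [Polynomial.eval_eq_sum_range, Polynomial.eval_eq_sum_range, Finset.sum_mul]
  refine Finset.sum_le_sum fun i hi => ?_
  rw [one_pow, mul_one]
  gcongr
  exact Nat.lt_succ_iff.1 (Finset.mem_range.1 hi)

theorem exists_eval_two_pow_le (P : Polynomial ℕ) (d : ℕ) :
    ∃ c C, ∀ k, P.eval (2 ^ (d * k)) ≤ 2 ^ (c * k) + C := by
  refine ⟨P.eval 1 + d * P.natDegree, P.eval 1, fun k => ?_⟩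
  obtain rfl | hk := Nat.eq_zero_or_pos k
  · simp
  refine le_add_right ?_
  calc P.eval (2 ^ (d * k)) ≤ P.eval 1 * (2 ^ (d * k)) ^ P.natDegree :=
        eval_le_mul_pow P (by positivity)
    _ ≤ 2 ^ (P.eval 1 * k) * (2 ^ (d * k)) ^ P.natDegree := by
        gcongr
        exact Nat.lt_two_pow_self.le.trans
          (Nat.pow_le_pow_right two_pos (Nat.le_mul_of_pos_right _ hk))
    _ = 2 ^ ((P.eval 1 + d * P.natDegree) * k) := by
        rw [← pow_mul, ← pow_add]
        ring

theorem exists_runs_answer (r : ℕ) : ∃ (p : Prog) (c : ℕ) (P : Polynomial ℕ),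
    ∀ (I : CSP r) (k : ℕ), ∃ t ≤ 2 ^ (c * k) + P.eval (CSP.enc I).size,
      p.Runs ((MaxCSP r).code I k) (encBool (I.answer k)) t := by
  obtain ⟨p, t, ⟨R, hR⟩, hp⟩ := CSP.polyTimeIn_answer (r := r)
  obtain ⟨c, C, hc⟩ := exists_eval_two_pow_le (R.comp (2 * (5 * .X))) (2 * r + 1)
  refine ⟨p, c, R.comp (2 * .X) + .C C, fun I k => ⟨t (I, k), ?_, hp (I, k)⟩⟩
  have hpow : 2 ^ ((2 * r + 1) * k) = 2 ^ (2 * r * k) * 2 ^ k := by rw [← pow_add]; ring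
  have hmeasure : tsize (I, k) + 2 ^ (2 * r * k) ≤ tsize I + 5 * 2 ^ ((2 * r + 1) * k) := by
    have hk := tsize_nat_le k
    have hlt : k < 2 ^ k := Nat.lt_two_pow_self
    have hone : 0 < 2 ^ (2 * r * k) := by positivity
    rw [tsize_pair]
    nlinarith
  have hsplit := (hR (I, k)).trans ((eval_le_eval R hmeasure).trans (eval_add_le R _ _))
  have hparam := hc k
  simp only [Polynomial.eval_comp, Polynomial.eval_add, Polynomial.eval_mul, Polynomial.eval_X,
    Polynomial.eval_C, Polynomial.eval_ofNat] at hparam ⊢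
  change _ ≤ _ + (R.eval (2 * tsize I) + C)
  omega

theorem encTable_size_lt (a : ℕ) (f : (Fin a → Bool) → Bool) :
    (encTable a f).size + 1 ≤ 4 * 2 ^ a := by
  induction a with
  | zero => rw [encTable]; cases f Fin.elim0 <;> simp [encBool, BTree.size]
  | succ a ih =>
    have hfalse := ih fun v => f (Fin.cons false v)
    have htrue := ih fun v => f (Fin.cons true v)
    rw [encTable, BTree.size, pow_succ]
    omega

theorem Constraint.tsize_le {n : ℕ} (c : Constraint r n) :
    tsize c ≤ r * (4 * n + 2) + 4 * 2 ^ r + 1 := by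
  have hvars : tsize c.vars ≤ c.vars.length * (4 * n + 2) + 1 :=
    tsize_list_le fun i _ => (tsize_nat_le i).trans (by omega)
  have hlength := Nat.mul_le_mul_right (4 * n + 2) c.length_le
  have htable := encTable_size_lt _ c.table
  have hpow := Nat.pow_le_pow_right two_pos c.length_le
  have htsize : tsize c = tsize c.vars + (encTable c.vars.length c.table).size + 1 := rfl
  omega

namespace CSP

theorem AllVarsOccur.numVars_le {I : CSP r} (h : I.AllVarsOccur) :
    I.numVars ≤ I.numConstraints * r := by
  have huniv : Finset.univ ⊆ (I.constraints.flatMap fun c => c.vars).toFinset := fun i _ => by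
    simpa using h i
  calc I.numVars = (Finset.univ : Finset (Fin I.numVars)).card := by simp
    _ ≤ (I.constraints.flatMap fun c => c.vars).length :=
        (Finset.card_le_card huniv).trans (List.toFinset_card_le _)
    _ = (I.constraints.map fun c => c.vars.length).sum := List.length_flatMap
    _ ≤ I.numConstraints * r := by
        simpa [numConstraints] using List.sum_le_card_nsmul
          (I.constraints.map fun c => c.vars.length) r (by simp +contextual [Constraint.length_le])

theorem exists_enc_size_le (r : ℕ) : ∃ Q : Polynomial ℕ, ∀ I : CSP r, I.AllVarsOccur →
    (CSP.enc I).size ≤ Q.eval I.numConstraints := by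
  refine ⟨.X * (.C r * (4 * (.X * .C r) + 2) + .C (4 * 2 ^ r + 1) + 1) + 4 * (.X * .C r) + 3,
    fun I h => ?_⟩
  have hvars := h.numVars_le
  have hconstraint : ∀ c ∈ I.constraints,
      tsize c ≤ r * (4 * (I.numConstraints * r) + 2) + (4 * 2 ^ r + 1) := fun c _ =>
    c.tsize_le.trans (by rw [add_assoc]; gcongr)
  have hconstraints := tsize_list_le hconstraint
  have hnumVars := tsize_nat_le I.numVars
  have htsize : (CSP.enc I).size = tsize I.numVars + tsize I.constraints + 1 := rfl
  simp only [Polynomial.eval_add, Polynomial.eval_mul, Polynomial.eval_X, Polynomial.eval_C,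
    Polynomial.eval_ofNat, Polynomial.eval_one]
  change _ ≤ I.numConstraints * _ + 1 at hconstraints
  omega

end CSP

end

theorem isBigOKLogK_const_mul (c : ℕ) : IsBigOKLogK fun k => c * k := by
  refine IsBigO.of_bound c ?_
  filter_upwards [eventually_ge_atTop 3] with k hk
  have hlog : 1 ≤ Real.log k := by
    rw [Real.le_log_iff_exp_le (by positivity)]
    exact (Real.exp_one_lt_three.trans_le (by exact_mod_cast hk)).le
  rw [Real.norm_of_nonneg (by positivity), Real.norm_of_nonneg (by positivity), Nat.cast_mul]
  gcongr
  exact le_mul_of_one_le_right (by positivity) hlog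

theorem mainTheorem9_general (r : ℕ) :
    (∃ F : CSP r → ℕ → LinSystem r × ℕ,
      IsBikernelization (MaxCSP r) (MaxLinAA r) F ∧ ∀ I k, (F I k).1.numVars ≤ 2 * r * k) ∧
    (∃ (p : Prog) (c : ℕ) (P Q : Polynomial ℕ), ∀ (I : CSP r) (k : ℕ), ∃ (b : Bool) (t : ℕ),
      p.Runs ((MaxCSP r).code I k) (encBool b) t ∧
      (b = true ↔ (MaxCSP r).Yes I k) ∧
      t ≤ 2 ^ (c * k) + P.eval (CSP.enc I).size ∧
      (I.AllVarsOccur → t ≤ 2 ^ (c * k) + Q.eval I.numConstraints)) := by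
  obtain ⟨p, c, P, hp⟩ := exists_runs_answer r
  obtain ⟨Q, hQ⟩ := CSP.exists_enc_size_le r
  refine ⟨⟨kernel, isBikernelization_kernel, numVars_kernel_le⟩, p, c, P, P.comp Q, fun I k => ?_⟩
  obtain ⟨t, ht, hrun⟩ := hp I k
  refine ⟨I.answer k, t, hrun, I.answer_eq_true_iff k, ht, fun hI => ht.trans ?_⟩
  rw [Polynomial.eval_comp]
  gcongr
  exact eval_le_eval P (hQ I hI)

theorem mainTheorem9 (r : ℕ) (hr : 2 ≤ r) :
    (∃ F : CSP r → ℕ → LinSystem r × ℕ,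
      IsBikernelization (MaxCSP r) (MaxLinAA r) F ∧
      ∃ g : ℕ → ℕ, IsBigOKLogK g ∧ ∀ I k, (F I k).1.numVars ≤ g k) ∧
    (∃ (p : Prog) (g : ℕ → ℕ) (P Q : Polynomial ℕ), IsBigOKLogK g ∧
      ∀ (I : CSP r) (k : ℕ), ∃ (b : Bool) (t : ℕ),
        p.Runs ((MaxCSP r).code I k) (encBool b) t ∧
        (b = true ↔ (MaxCSP r).Yes I k) ∧
        t ≤ 2 ^ g k + P.eval (CSP.enc I).size ∧
        (I.AllVarsOccur → t ≤ 2 ^ g k + Q.eval I.numConstraints)) := by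
  obtain ⟨⟨F, hF, hn⟩, p, c, P, Q, hp⟩ := mainTheorem9_general r
  exact ⟨⟨F, hF, _, isBigOKLogK_const_mul (2 * r), hn⟩, p, _, P, Q, isBigOKLogK_const_mul c, hp⟩
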